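/- Let $(\mathcal C,\otimes,I,\psi)$ be a symmetric monoidal category whose underlying category is abelian. Associativity and unit isomorphisms are suppressed, $1$ denotes identities, $(f,g)$ denotes $f\otimes g$, $A^n$ denotes $A^{\otimes n}$, and composition is written right to left. Let $(H,m,\eta,\Delta,\varepsilon,S)$ be a Hopf algebra in $\mathcal C$. Let $(C,\Delta_C,\varepsilon_C,\phi_C)$ be a left $H$-module coalgebra in $\mathcal C$: a coalgebra with a left $H$-module structure $\phi_C:H\otimes C\to C$ such that $\Delta_C\phi_C=(\phi_C,\phi_C)(1_H,\psi_{H,C},1_C)(\Delta,\Delta_C)$ and $\varepsilon_C\phi_C=\varepsilon\otimes\varepsilon_C$. Let $M$ be a right-left braided stable anti-Yetter–Drinfeld $H$-module: a right $H$-module $\phi_M:M\otimes H\to M$ and left $H$-comodule $\rho_M:M\to H\otimes M$ such that $$\rho_M\phi_M=\big(m(S,m),\phi_M\big)(\psi_{H^2,H},1_M,1_H)(1_{H^2},\psi_{M,H},1_H)(1_{H^2},1_M,\psi_{H,H})(1_H,\psi_{M,H},1_{H^2})\big(\rho_M,(1_H,\Delta)\Delta\big)$$ and $\phi_M\psi_{H,M}\rho_M=1_M$.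 For $n\ge 0$ put $C^n(C,M)=M\otimes C^{n+1}$, and define faces $\delta_i:C^{n-1}(C,M)\to C^n(C,M)$ ($n\ge1$, $0\le i\le n$), degeneracies $\sigma_i:C^{n+1}(C,M)\to C^n(C,M)$ ($0\le i\le n$) and cyclic maps $\tau_n:C^n(C,M)\to C^n(C,M)$ by $$\delta_i=(1_M,1_{C^i},\Delta_C,1_{C^{n-i-1}})\ \ (0\le i<n),\qquad \delta_n=(1_M,\psi_{C,C^n})(1_M,\phi_C,1_{C^n})(\psi_{H,M},1_{C^{n+1}})(\rho_M,\Delta_C,1_{C^{n-1}}),$$ $$\sigma_i=(1_M,1_{C^{i+1}},\varepsilon_C,1_{C^{n-i}}),\qquad \tau_n=(1_M,\psi_{C,C^n})(1_M,\phi_C,1_{C^n})(\psi_{H,M},1_{C^{n+1}})(\rho_M,1_{C^{n+1}}).$$ Let $H$ act on $C^{n+1}$ by the diagonal action $\phi_{C^{n+1}}:H\otimes C^{n+1}\to C^{n+1}$, obtained by applying the iterated comultiplication $H\to H^{n+1}$, then shuffling $H^{n+1}\otimes C^{n+1}\to(H\otimes C)^{n+1}$ by means of $\psi_{H,C}$,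 then applying $\phi_C$ in each factor. Let $$C^n_H(C,M)=M\otimes_H C^{n+1}=\operatorname{coker}\big(\phi_M\otimes 1_{C^{n+1}}-1_M\otimes\phi_{C^{n+1}}:M\otimes H\otimes C^{n+1}\to M\otimes C^{n+1}\big).$$ Then all the maps $\delta_i,\sigma_i,\tau_n$ descend to unique maps $\widetilde\delta_i,\widetilde\sigma_i,\widetilde\tau_n$ between the objects $C^n_H(C,M)$, commuting with the quotient maps $M\otimes C^{n+1}\to M\otimes_HC^{n+1}$, and $(C^\bullet_H(C,M),\widetilde\delta_i,\widetilde\sigma_i,\widetilde\tau_n)$ is a cocyclic object in $\mathcal C$. That is, the cosimplicial identities $$\widetilde\delta_j\widetilde\delta_i=\widetilde\delta_i\widetilde\delta_{j-1}\ (i<j),\quad \widetilde\sigma_j\widetilde\sigma_i=\widetilde\sigma_i\widetilde\sigma_{j+1}\ (i\le j),\quad \widetilde\sigma_j\widetilde\delta_i=\begin{cases}\widetilde\delta_i\widetilde\sigma_{j-1}& i<j\\ \mathrm{id}& i=j,\,j+1\\ \widetilde\delta_{i-1}\widetilde\sigma_j& i>j+1\end{cases}$$ hold, together with the cyclic relations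 $$\widetilde\tau_n\widetilde\delta_i=\widetilde\delta_{i-1}\widetilde\tau_{n-1}\ (1\le i\le n),\qquad \widetilde\tau_n\widetilde\delta_0=\widetilde\delta_n,$$ $$\widetilde\tau_n\widetilde\sigma_i=\widetilde\sigma_{i-1}\widetilde\tau_{n+1}\ (1\le i\le n),\qquad \widetilde\tau_n\widetilde\sigma_0=\widetilde\sigma_n\widetilde\tau_{n+1}^2,\qquad \widetilde\tau_n^{\,n+1}=\mathrm{id}.$$ -/

import Mathlib

open CategoryTheory MonoidalCategory Limits
open scoped MonObj ComonObj HopfObj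

universe v u

noncomputable section

namespace BraidedHopfCyclic

/-! ### Cocyclic objects -/

section Cocyclic

variable {𝒞 : Type u} [Category.{v} 𝒞]

/-- Candidate cofaces `δ_i : X n ⟶ X (n+1)` for `0 ≤ i ≤ n+1`, codegeneracies
`σ_i : X (n+1) ⟶ X n` for `0 ≤ i ≤ n`, and cyclic maps `τ_n : X n ⟶ X n`
on a sequence of objects (no relations imposed). -/
@[ext]
structure CocyclicOperators (X : ℕ → 𝒞) where
  δ : ∀ n : ℕ, Fin (n + 2) → (X n ⟶ X (n + 1))
  σ : ∀ n : ℕ, Fin (n + 1) → (X (n + 1) ⟶ X n)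
  τ : ∀ n : ℕ, X n ⟶ X n

/-- The operators make `X` a cocyclic object: the cosimplicial identities, the compatibility
of the cyclic maps with cofaces and codegeneracies, and `τ_n ^ (n + 1) = id`. -/
structure CocyclicOperators.IsCocyclic {X : ℕ → 𝒞} (D : CocyclicOperators X) : Prop where
  δ_comp_δ : ∀ (n : ℕ) (i j : Fin (n + 2)), i ≤ j →
    D.δ n i ≫ D.δ (n + 1) j.succ = D.δ n j ≫ D.δ (n + 1) i.castSucc
  σ_comp_σ : ∀ (n : ℕ) (i j : Fin (n + 1)), i ≤ j →
    D.σ (n + 1) i.castSucc ≫ D.σ n j = D.σ (n + 1) j.succ ≫ D.σ n i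
  δ_comp_σ_of_le : ∀ (n : ℕ) (i : Fin (n + 2)) (j : Fin (n + 1)), i ≤ j.castSucc →
    D.δ (n + 1) i.castSucc ≫ D.σ (n + 1) j.succ = D.σ n j ≫ D.δ n i
  δ_comp_σ_self : ∀ (n : ℕ) (i : Fin (n + 1)), D.δ n i.castSucc ≫ D.σ n i = 𝟙 (X n)
  δ_comp_σ_succ : ∀ (n : ℕ) (i : Fin (n + 1)), D.δ n i.succ ≫ D.σ n i = 𝟙 (X n)
  δ_comp_σ_of_gt : ∀ (n : ℕ) (i : Fin (n + 2)) (j : Fin (n + 1)), j.castSucc < i →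
    D.δ (n + 1) i.succ ≫ D.σ (n + 1) j.castSucc = D.σ n j ≫ D.δ n i
  δ_zero_comp_τ : ∀ n : ℕ, D.δ n 0 ≫ D.τ (n + 1) = D.δ n (Fin.last (n + 1))
  δ_succ_comp_τ : ∀ (n : ℕ) (i : Fin (n + 1)),
    D.δ n i.succ ≫ D.τ (n + 1) = D.τ n ≫ D.δ n i.castSucc
  σ_zero_comp_τ : ∀ n : ℕ,
    D.σ n 0 ≫ D.τ n = D.τ (n + 1) ≫ D.τ (n + 1) ≫ D.σ n (Fin.last n)
  σ_succ_comp_τ : ∀ (n : ℕ) (i : Fin n),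
    D.σ n i.succ ≫ D.τ n = D.τ (n + 1) ≫ D.σ n i.castSucc
  τ_pow : ∀ n : ℕ, (End.of (D.τ n)) ^ (n + 1) = 1

end Cocyclic

/-! ### Modules, comodules and module coalgebras -/

section Structures

variable {𝒞 : Type u} [Category.{v} 𝒞] [MonoidalCategory 𝒞]

/-- A right module over a monoid object. -/
class RightModObj (H : 𝒞) [MonObj H] (M : 𝒞) where
  act : M ⊗ H ⟶ M
  act_one : M ◁ η[H] ≫ act = (ρ_ M).hom
  act_mul : M ◁ μ[H] ≫ act = (α_ M H H).inv ≫ act ▷ H ≫ act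

/-- A left comodule over a comonoid object. -/
class LeftComodObj (H : 𝒞) [ComonObj H] (M : 𝒞) where
  coact : M ⟶ H ⊗ M
  counit_coact : coact ≫ ε[H] ▷ M = (λ_ M).inv
  comul_coact : coact ≫ Δ[H] ▷ M = coact ≫ H ◁ coact ≫ (α_ H H M).inv

variable [BraidedCategory 𝒞]

/-- A left `H`-module coalgebra: a comonoid object with a left `H`-action that is a
morphism of coalgebras. -/
class ModuleCoalgObj (H : 𝒞) [HopfObj H] (C : 𝒞) extends ComonObj C, ModObj H C where
  smul_comul : (γ[H, C] : H ⊗ C ⟶ C) ≫ Δ[C] =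
    (Δ[H] ⊗ₘ Δ[C]) ≫ tensorμ H H C C ≫ ((γ[H, C] : H ⊗ C ⟶ C) ⊗ₘ (γ[H, C] : H ⊗ C ⟶ C))
  smul_counit : (γ[H, C] : H ⊗ C ⟶ C) ≫ ε[C] = (ε[H] ⊗ₘ ε[C]) ≫ (λ_ (𝟙_ 𝒞)).hom

/-- A right-left braided stable anti-Yetter–Drinfeld module over `H`.  In Sweedler notation
(with the symmetries suppressed) the two axioms read
`(m h)₍₋₁₎ ⊗ (m h)₍₀₎ = S(h⁽³⁾) (m₍₋₁₎ h⁽¹⁾) ⊗ m₍₀₎ h⁽²⁾` and `m₍₀₎ m₍₋₁₎ = m`. -/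
class SAYDObj (H : 𝒞) [HopfObj H] (M : 𝒞) extends RightModObj H M, LeftComodObj H M where
  anti_yetter_drinfeld :
    act ≫ coact =
      (coact ⊗ₘ (Δ[H] ≫ H ◁ Δ[H])) ⊗≫
        H ◁ (β_ M H).hom ▷ (H ⊗ H) ⊗≫
        (H ⊗ H ⊗ M) ◁ (β_ H H).hom ⊗≫
        (H ⊗ H) ◁ (β_ M H).hom ▷ H ⊗≫
        (β_ (H ⊗ H) H).hom ▷ (M ⊗ H) ⊗≫
        (((𝒮[H] ⊗ₘ μ[H]) ≫ μ[H]) ⊗ₘ act)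
  stable : coact ≫ (β_ H M).hom ≫ act = 𝟙 M

end Structures

/-! ### Tensor powers -/

section TensorPowers

variable {𝒞 : Type u} [Category.{v} 𝒞] [MonoidalCategory 𝒞]

/-- The tensor power `A ^ n = A ⊗ (A ⊗ (⋯ ⊗ (A ⊗ 𝟙_)))`. -/
def tpow (A : 𝒞) : ℕ → 𝒞
  | 0 => 𝟙_ 𝒞
  | n + 1 => A ⊗ tpow A n

/-- The tensor power `f ^ n : A ^ n ⟶ B ^ n` of a morphism. -/
def tpowMap {A B : 𝒞} (f : A ⟶ B) : ∀ n : ℕ, tpow A n ⟶ tpow B n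
  | 0 => 𝟙 (𝟙_ 𝒞)
  | n + 1 => f ⊗ₘ tpowMap f n

/-- The coherence isomorphism `A ^ n ⊗ A ≅ A ^ (n + 1)`. -/
def tpowSnoc (A : 𝒞) : ∀ n : ℕ, tpow A n ⊗ A ≅ tpow A (n + 1)
  | 0 => λ_ A ≪≫ (ρ_ A).symm
  | n + 1 => α_ A (tpow A n) A ≪≫ whiskerLeftIso A (tpowSnoc A n)

/-- `1_{C^i} ⊗ Δ_C ⊗ 1_{C^{n-i-1}} : C ^ n ⟶ C ^ (n + 1)`, comultiplying the `i`-th factor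
(factors numbered from `0`). -/
def comulAt (C : 𝒞) [ComonObj C] : ∀ n : ℕ, Fin n → (tpow C n ⟶ tpow C (n + 1))
  | 0 => fun i => i.elim0
  | n + 1 => Fin.cases (Δ[C] ▷ tpow C n ≫ (α_ C C (tpow C n)).hom)
      (fun i => C ◁ comulAt C n i)

/-- `1_{C^i} ⊗ ε_C ⊗ 1_{C^{n-i}} : C ^ (n + 1) ⟶ C ^ n`, applying the counit to the `i`-th
factor (factors numbered from `0`). -/
def counitAt (C : 𝒞) [ComonObj C] : ∀ n : ℕ, Fin (n + 1) → (tpow C (n + 1) ⟶ tpow C n)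
  | 0 => fun _ => ε[C] ▷ 𝟙_ 𝒞 ≫ (λ_ (𝟙_ 𝒞)).hom
  | n + 1 => Fin.cases (ε[C] ▷ tpow C (n + 1) ≫ (λ_ (tpow C (n + 1))).hom)
      (fun i => C ◁ counitAt C n i)

/-- The iterated comultiplication `H ⟶ H ^ n`; it is the counit for `n = 0` and, up to the
unit isomorphism `H ≅ H ⊗ 𝟙_`, the identity for `n = 1`. -/
def iterComul (H : 𝒞) [ComonObj H] : ∀ n : ℕ, H ⟶ tpow H n
  | 0 => ε[H]
  | n + 1 => Δ[H] ≫ H ◁ iterComul H n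

variable [BraidedCategory 𝒞]

/-- The shuffle `A ^ n ⊗ B ^ n ⟶ (A ⊗ B) ^ n`, built from the braidings `β_ A B`, that keeps
the order of the `A`s and the order of the `B`s. -/
def tpowShuffle (A B : 𝒞) : ∀ n : ℕ, tpow A n ⊗ tpow B n ⟶ tpow (A ⊗ B) n
  | 0 => (λ_ (𝟙_ 𝒞)).hom
  | n + 1 => tensorμ A (tpow A n) B (tpow B n) ≫ (A ⊗ B) ◁ tpowShuffle A B n

/-- The diagonal action `H ⊗ C ^ n ⟶ C ^ n`. -/
def diagAct (H C : 𝒞) [HopfObj H] [ModObj H C] (n : ℕ) : H ⊗ tpow C n ⟶ tpow C n :=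
  iterComul H n ▷ tpow C n ≫ tpowShuffle H C n ≫ tpowMap (γ[H, C] : H ⊗ C ⟶ C) n

end TensorPowers

/-! ### The operators on `M ⊗ C ^ (n + 1)` -/

section Operators

variable {𝒞 : Type u} [Category.{v} 𝒞] [MonoidalCategory 𝒞] [BraidedCategory 𝒞]
variable (H C M : 𝒞) [HopfObj H] [ModuleCoalgObj H C] [SAYDObj H M]

/-- The composite `(1_M, ψ_{C,C^n}) (1_M, φ_C, 1_{C^n}) (ψ_{H,M}, 1_{C^{n+1}})`. -/
def twist (n : ℕ) : (H ⊗ M) ⊗ tpow C (n + 1) ⟶ M ⊗ tpow C (n + 1) :=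
  (β_ H M).hom ▷ (C ⊗ tpow C n) ≫
    (α_ M H (C ⊗ tpow C n)).hom ≫
    M ◁ ((α_ H C (tpow C n)).inv ≫
      (γ[H, C] : H ⊗ C ⟶ C) ▷ tpow C n ≫
      (β_ C (tpow C n)).hom ≫
      (tpowSnoc C n).hom)

/-- The faces, degeneracies and cyclic maps on `C^n(C, M) = M ⊗ C ^ (n + 1)`. -/
def operators : CocyclicOperators (fun n : ℕ => M ⊗ tpow C (n + 1)) where
  δ n := Fin.lastCases
    (((LeftComodObj.coact : M ⟶ H ⊗ M) ⊗ₘ comulAt C (n + 1) 0) ≫ twist H C M (n + 1))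
    (fun i : Fin (n + 1) => M ◁ comulAt C (n + 1) i)
  σ n i := M ◁ counitAt C (n + 1) i.succ
  τ n := (LeftComodObj.coact : M ⟶ H ⊗ M) ▷ tpow C (n + 1) ≫ twist H C M n

end Operators

/-! ### Balanced tensor products -/

section Balanced

variable {𝒞 : Type u} [Category.{v} 𝒞] [MonoidalCategory 𝒞] [Abelian 𝒞]

/-- The map `φ_V ⊗ 1_W - 1_V ⊗ φ_W : V ⊗ H ⊗ W ⟶ V ⊗ W`. -/
def balancingMap {H V W : 𝒞} (φV : V ⊗ H ⟶ V) (φW : H ⊗ W ⟶ W) : (V ⊗ H) ⊗ W ⟶ V ⊗ W :=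
  φV ▷ W - (α_ V H W).hom ≫ V ◁ φW

variable [BraidedCategory 𝒞]
variable (H C M : 𝒞) [HopfObj H] [ModuleCoalgObj H C] [SAYDObj H M]

/-- `C^n_H(C, M) = M ⊗_H C ^ (n + 1)`. -/
def balanced (n : ℕ) : 𝒞 :=
  cokernel (balancingMap (RightModObj.act : M ⊗ H ⟶ M) (diagAct H C (n + 1)))

/-- The quotient map `M ⊗ C ^ (n + 1) ⟶ M ⊗_H C ^ (n + 1)`. -/
def balancedπ (n : ℕ) : M ⊗ tpow C (n + 1) ⟶ balanced H C M n :=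
  cokernel.π (balancingMap (RightModObj.act : M ⊗ H ⟶ M) (diagAct H C (n + 1)))

/-- The operators `D` on the balanced tensor products are induced by those on
`M ⊗ C ^ (n + 1)`. -/
structure IsInduced (D : CocyclicOperators (balanced H C M)) : Prop where
  δ : ∀ (n : ℕ) (i : Fin (n + 2)),
    balancedπ H C M n ≫ D.δ n i = (operators H C M).δ n i ≫ balancedπ H C M (n + 1)
  σ : ∀ (n : ℕ) (i : Fin (n + 1)),
    balancedπ H C M (n + 1) ≫ D.σ n i = (operators H C M).σ n i ≫ balancedπ H C M n
  τ : ∀ n : ℕ, balancedπ H C M n ≫ D.τ n = (operators H C M).τ n ≫ balancedπ H C M n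

end Balanced

end BraidedHopfCyclic

end

noncomputable section

namespace BraidedHopfCyclic

open BraidedCategory

/-!
Let `τ` denote the cyclic map `m ⊗ c ⊗ x ↦ m₍₀₎ ⊗ x ⊗ m₍₋₁₎ c`. On `M ⊗ C ^ (n + 1)` the operators
satisfy all relations of a cocyclic object except `τ ^ (n + 1) = 1`.

The faces and degeneracies descend to `M ⊗_H C ^ (n + 1)` because `Δ_C` and `ε_C` are `H`-linear.
For `τ`, the anti-Yetter–Drinfeld condition gives
`τ (m h ⊗ c ⊗ x) = m₍₀₎ h⁽²⁾ ⊗ x ⊗ S(h⁽³⁾) m₍₋₁₎ h⁽¹⁾ c`, and moving `h⁽²⁾` across the balanced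
tensor product cancels the antipode:
`m₍₀₎ ⊗ h⁽²⁾ x ⊗ h⁽³⁾ S(h⁽⁴⁾) m₍₋₁₎ h⁽¹⁾ c = m₍₀₎ ⊗ h⁽²⁾ x ⊗ m₍₋₁₎ h⁽¹⁾ c = τ (m ⊗ h (c ⊗ x))`.

Finally `τ ^ (n + 1)` is `m ⊗ y ↦ m₍₀₎ ⊗ m₍₋₁₎ y`, which the quotient identifies with
`m₍₀₎ m₍₋₁₎ ⊗ y = m ⊗ y` by stability.
-/

section Paracocyclic

variable {𝒞 : Type u} [Category.{v} 𝒞] {X Y : ℕ → 𝒞}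

namespace CocyclicOperators

/-- Morphisms `f n : X n ⟶ Y n` that commute with the operators `D` on `X` and `E` on `Y`. -/
structure IsHom (D : CocyclicOperators X) (E : CocyclicOperators Y) (f : ∀ n, X n ⟶ Y n) :
    Prop where
  δ : ∀ (n : ℕ) (i : Fin (n + 2)), f n ≫ E.δ n i = D.δ n i ≫ f (n + 1)
  σ : ∀ (n : ℕ) (i : Fin (n + 1)), f (n + 1) ≫ E.σ n i = D.σ n i ≫ f n
  τ : ∀ n : ℕ, f n ≫ E.τ n = D.τ n ≫ f n

/-- The relations of a cocyclic object without `τ_n ^ (n + 1) = id`. Since the last coface is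
determined by `δ_{n+1} = τ δ_0`, relations containing it are only imposed where they are not
consequences of the others. -/
structure IsParacocyclic (D : CocyclicOperators X) : Prop where
  inner_δ_comp_δ : ∀ (n : ℕ) (i j : Fin (n + 1)), i ≤ j →
    D.δ n i.castSucc ≫ D.δ (n + 1) j.castSucc.succ =
      D.δ n j.castSucc ≫ D.δ (n + 1) i.castSucc.castSucc
  σ_comp_σ : ∀ (n : ℕ) (i j : Fin (n + 1)), i ≤ j →
    D.σ (n + 1) i.castSucc ≫ D.σ n j = D.σ (n + 1) j.succ ≫ D.σ n i
  inner_δ_comp_σ_of_le : ∀ (n : ℕ) (i j : Fin (n + 1)), i ≤ j →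
    D.δ (n + 1) i.castSucc.castSucc ≫ D.σ (n + 1) j.succ = D.σ n j ≫ D.δ n i.castSucc
  δ_comp_σ_self : ∀ (n : ℕ) (i : Fin (n + 1)), D.δ n i.castSucc ≫ D.σ n i = 𝟙 (X n)
  δ_comp_σ_succ : ∀ (n : ℕ) (i : Fin (n + 1)), D.δ n i.succ ≫ D.σ n i = 𝟙 (X n)
  inner_δ_comp_σ_of_gt : ∀ (n : ℕ) (i j : Fin (n + 1)), j < i →
    D.δ (n + 1) i.castSucc.succ ≫ D.σ (n + 1) j.castSucc = D.σ n j ≫ D.δ n i.castSucc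
  δ_zero_comp_τ : ∀ n : ℕ, D.δ n 0 ≫ D.τ (n + 1) = D.δ n (Fin.last (n + 1))
  δ_succ_comp_τ : ∀ (n : ℕ) (i : Fin (n + 1)),
    D.δ n i.succ ≫ D.τ (n + 1) = D.τ n ≫ D.δ n i.castSucc
  σ_zero_comp_τ : ∀ n : ℕ,
    D.σ n 0 ≫ D.τ n = D.τ (n + 1) ≫ D.τ (n + 1) ≫ D.σ n (Fin.last n)
  σ_succ_comp_τ : ∀ (n : ℕ) (i : Fin n),
    D.σ n i.succ ≫ D.τ n = D.τ (n + 1) ≫ D.σ n i.castSucc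

variable {D : CocyclicOperators X}

namespace IsHom

variable {E E' : CocyclicOperators Y} {f : ∀ n, X n ⟶ Y n}

theorem τ_pow (h : IsHom D E f) (n k : ℕ) :
    f n ≫ (End.of (E.τ n) ^ k : End (Y n)) = (End.of (D.τ n) ^ k : End (X n)) ≫ f n := by
  induction k with
  | zero => exact (Category.comp_id _).trans (Category.id_comp _).symm
  | succ k ih =>
    rw [pow_succ, pow_succ, End.mul_def, End.mul_def, Category.assoc, ← ih]
    exact (reassoc_of% h.τ n) _

variable [∀ n, Epi (f n)]

theorem unique (h : IsHom D E f) (h' : IsHom D E' f) : E = E' := by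
  ext n
  · rw [← cancel_epi (f n), h.δ, h'.δ]
  · rw [← cancel_epi (f (n + 1)), h.σ, h'.σ]
  · rw [← cancel_epi (f n), h.τ, h'.τ]

theorem isParacocyclic (h : IsHom D E f) (hD : D.IsParacocyclic) : E.IsParacocyclic := by
  constructor
  all_goals intros; rw [← cancel_epi (f _)]
  case inner_δ_comp_δ hij =>
    simp only [reassoc_of% h.δ, h.δ, reassoc_of% hD.inner_δ_comp_δ _ _ _ hij]
  case σ_comp_σ hij => simp only [reassoc_of% h.σ, h.σ, reassoc_of% hD.σ_comp_σ _ _ _ hij]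
  case inner_δ_comp_σ_of_le hij =>
    simp only [reassoc_of% h.δ, reassoc_of% h.σ, h.δ, h.σ,
      reassoc_of% hD.inner_δ_comp_σ_of_le _ _ _ hij]
  case δ_comp_σ_self =>
    rw [reassoc_of% h.δ, h.σ, reassoc_of% hD.δ_comp_σ_self, Category.comp_id]
  case δ_comp_σ_succ =>
    rw [reassoc_of% h.δ, h.σ, reassoc_of% hD.δ_comp_σ_succ, Category.comp_id]
  case inner_δ_comp_σ_of_gt hij =>
    simp only [reassoc_of% h.δ, reassoc_of% h.σ, h.δ, h.σ,
      reassoc_of% hD.inner_δ_comp_σ_of_gt _ _ _ hij]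
  case δ_zero_comp_τ =>
    rw [reassoc_of% h.δ, h.τ, h.δ, ← hD.δ_zero_comp_τ, Category.assoc]
  case δ_succ_comp_τ =>
    rw [reassoc_of% h.δ, h.τ, reassoc_of% h.τ, h.δ, reassoc_of% hD.δ_succ_comp_τ]
  case σ_zero_comp_τ =>
    rw [reassoc_of% h.σ, h.τ, reassoc_of% h.τ, reassoc_of% h.τ, h.σ,
      reassoc_of% hD.σ_zero_comp_τ]
  case σ_succ_comp_τ =>
    rw [reassoc_of% h.σ, h.τ, reassoc_of% h.τ, h.σ, reassoc_of% hD.σ_succ_comp_τ]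

end IsHom

namespace IsParacocyclic

theorem δ_comp_δ_last (hD : D.IsParacocyclic) (n : ℕ) (i : Fin (n + 2)) :
    D.δ n i ≫ D.δ (n + 1) (Fin.last (n + 2)) =
      D.δ n (Fin.last (n + 1)) ≫ D.δ (n + 1) i.castSucc := by
  have h₀ (j : Fin (n + 1)) := hD.inner_δ_comp_δ n 0 j (Fin.zero_le _)
  have hτ₀ : D.δ (n + 1) 1 ≫ D.τ (n + 2) = D.τ (n + 1) ≫ D.δ (n + 1) 0 :=
    hD.δ_succ_comp_τ (n + 1) 0
  rw [← hD.δ_zero_comp_τ n, Category.assoc, ← hD.δ_succ_comp_τ]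
  induction i using Fin.lastCases with
  | last =>
    rw [Fin.succ_last, ← hD.δ_zero_comp_τ (n + 1), ← hD.δ_zero_comp_τ n, Category.assoc,
      Category.assoc, ← reassoc_of% hτ₀]
    exact (reassoc_of% h₀ 0) _
  | cast i =>
    rw [← hD.δ_zero_comp_τ (n + 1)]
    exact ((reassoc_of% h₀ i) _).symm

theorem δ_comp_δ (hD : D.IsParacocyclic) (n : ℕ) (i j : Fin (n + 2)) (hij : i ≤ j) :
    D.δ n i ≫ D.δ (n + 1) j.succ = D.δ n j ≫ D.δ (n + 1) i.castSucc := by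
  induction j using Fin.lastCases with
  | last => exact hD.δ_comp_δ_last n i
  | cast j =>
    obtain ⟨i, rfl⟩ := Fin.exists_castSucc_eq.2 (hij.trans_lt (Fin.castSucc_lt_last j)).ne
    exact hD.inner_δ_comp_δ n i j hij

theorem δ_comp_σ_of_le (hD : D.IsParacocyclic) (n : ℕ) (i : Fin (n + 2)) (j : Fin (n + 1))
    (hij : i ≤ j.castSucc) :
    D.δ (n + 1) i.castSucc ≫ D.σ (n + 1) j.succ = D.σ n j ≫ D.δ n i := by
  obtain ⟨i, rfl⟩ := Fin.exists_castSucc_eq.2 (hij.trans_lt (Fin.castSucc_lt_last j)).ne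
  exact hD.inner_δ_comp_σ_of_le n i j hij

theorem δ_last_comp_σ (hD : D.IsParacocyclic) (n : ℕ) (j : Fin (n + 1)) :
    D.δ (n + 1) (Fin.last (n + 2)) ≫ D.σ (n + 1) j.castSucc =
      D.σ n j ≫ D.δ n (Fin.last (n + 1)) := by
  have hτ := hD.σ_succ_comp_τ (n + 1) j
  have h₀ := hD.δ_comp_σ_of_le n 0 j (Fin.zero_le _)
  rw [Fin.castSucc_zero] at h₀
  rw [← hD.δ_zero_comp_τ, ← hD.δ_zero_comp_τ, Category.assoc, ← hτ, reassoc_of% h₀]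

theorem δ_comp_σ_of_gt (hD : D.IsParacocyclic) (n : ℕ) (i : Fin (n + 2)) (j : Fin (n + 1))
    (hij : j.castSucc < i) :
    D.δ (n + 1) i.succ ≫ D.σ (n + 1) j.castSucc = D.σ n j ≫ D.δ n i := by
  induction i using Fin.lastCases with
  | last => exact hD.δ_last_comp_σ n j
  | cast i => exact hD.inner_δ_comp_σ_of_gt n i j hij

theorem isCocyclic (hD : D.IsParacocyclic)
    (τ_pow : ∀ n : ℕ, End.of (D.τ n) ^ (n + 1) = 1) : D.IsCocyclic where
  __ := hD
  δ_comp_δ := hD.δ_comp_δ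
  δ_comp_σ_of_le := hD.δ_comp_σ_of_le
  δ_comp_σ_of_gt := hD.δ_comp_σ_of_gt
  τ_pow := τ_pow

end IsParacocyclic

end CocyclicOperators

end Paracocyclic

section Intertwiners

variable {𝒞 : Type u} [Category.{v} 𝒞] [MonoidalCategory 𝒞] {H : 𝒞}

/-- `f` intertwines the action maps `φ` and `χ`. -/
def Intertwines {V W : 𝒞} (φ : H ⊗ V ⟶ V) (χ : H ⊗ W ⟶ W) (f : V ⟶ W) : Prop :=
  φ ≫ f = H ◁ f ≫ χ

theorem Intertwines.id {V : 𝒞} (φ : H ⊗ V ⟶ V) : Intertwines φ φ (𝟙 V) := by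
  simp [Intertwines]

theorem Intertwines.comp {U V W : 𝒞} {φ : H ⊗ U ⟶ U} {χ : H ⊗ V ⟶ V} {ω : H ⊗ W ⟶ W}
    {f : U ⟶ V} {g : V ⟶ W} (hf : Intertwines φ χ f) (hg : Intertwines χ ω g) :
    Intertwines φ ω (f ≫ g) := by
  unfold Intertwines at *
  rw [reassoc_of% hf, hg, whiskerLeft_comp, Category.assoc]

theorem Intertwines.iso_inv {V W : 𝒞} {φ : H ⊗ V ⟶ V} {χ : H ⊗ W ⟶ W} {e : V ≅ W}
    (he : Intertwines φ χ e.hom) : Intertwines χ φ e.inv := by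
  unfold Intertwines at *
  rw [← cancel_epi (H ◁ e.hom), ← reassoc_of% he]
  simp

end Intertwiners

section ActionMaps

variable {𝒞 : Type u} [Category.{v} 𝒞] [MonoidalCategory 𝒞] [BraidedCategory 𝒞]
variable {H : 𝒞} [ComonObj H]

/-- The diagonal action on a tensor product of two objects with `H`-actions. -/
def tensorAct {V W : 𝒞} (φ : H ⊗ V ⟶ V) (χ : H ⊗ W ⟶ W) : H ⊗ (V ⊗ W) ⟶ V ⊗ W :=
  Δ[H] ▷ (V ⊗ W) ≫ tensorμ H H V W ≫ (φ ⊗ₘ χ)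

variable (H) in
/-- The trivial action on the unit object. -/
def unitAct : H ⊗ 𝟙_ 𝒞 ⟶ 𝟙_ 𝒞 := ε[H] ▷ 𝟙_ 𝒞 ≫ (λ_ (𝟙_ 𝒞)).hom

theorem Intertwines.tensorHom {V V' W W' : 𝒞} {φ : H ⊗ V ⟶ V} {φ' : H ⊗ V' ⟶ V'}
    {χ : H ⊗ W ⟶ W} {χ' : H ⊗ W' ⟶ W'} {f : V ⟶ V'} {g : W ⟶ W'}
    (hf : Intertwines φ φ' f) (hg : Intertwines χ χ' g) :
    Intertwines (tensorAct φ χ) (tensorAct φ' χ') (f ⊗ₘ g) := by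
  unfold Intertwines tensorAct at *
  rw [whisker_exchange_assoc, tensorμ_natural_right_assoc]
  simp only [Category.assoc, tensorHom_comp_tensorHom, hf, hg]

theorem Intertwines.whiskerLeft {V W W' : 𝒞} (φ : H ⊗ V ⟶ V)
    {χ : H ⊗ W ⟶ W} {χ' : H ⊗ W' ⟶ W'} {g : W ⟶ W'} (hg : Intertwines χ χ' g) :
    Intertwines (tensorAct φ χ) (tensorAct φ χ') (V ◁ g) := by
  rw [← id_tensorHom]
  exact (Intertwines.id φ).tensorHom hg

theorem Intertwines.whiskerRight {V V' W : 𝒞} {φ : H ⊗ V ⟶ V} {φ' : H ⊗ V' ⟶ V'}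
    {f : V ⟶ V'} (hf : Intertwines φ φ' f) (χ : H ⊗ W ⟶ W) :
    Intertwines (tensorAct φ χ) (tensorAct φ' χ) (f ▷ W) := by
  rw [← tensorHom_id]
  exact hf.tensorHom (Intertwines.id χ)

theorem tensorAct_tensorAct_left {U V W : 𝒞} (φ : H ⊗ U ⟶ U) (χ : H ⊗ V ⟶ V) (ω : H ⊗ W ⟶ W) :
    tensorAct (tensorAct φ χ) ω = (Δ[H] ≫ Δ[H] ▷ H) ▷ ((U ⊗ V) ⊗ W) ≫
      tensorμ (H ⊗ H) H (U ⊗ V) W ≫ tensorμ H H U V ▷ (H ⊗ W) ≫ ((φ ⊗ₘ χ) ⊗ₘ ω) := by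
  have hμ := tensorμ_natural_left Δ[H] (𝟙 H) (U ⊗ V) W
  simp only [tensorHom_id, id_whiskerRight] at hμ
  rw [comp_whiskerRight_assoc, reassoc_of% hμ]
  simp only [tensorAct, ← tensorHom_id, tensorHom_comp_tensorHom, Category.id_comp]

theorem tensorAct_tensorAct_right {U V W : 𝒞} (φ : H ⊗ U ⟶ U) (χ : H ⊗ V ⟶ V)
    (ω : H ⊗ W ⟶ W) :
    tensorAct φ (tensorAct χ ω) = (Δ[H] ≫ H ◁ Δ[H]) ▷ (U ⊗ V ⊗ W) ≫
      tensorμ H (H ⊗ H) U (V ⊗ W) ≫ (H ⊗ U) ◁ tensorμ H H V W ≫ (φ ⊗ₘ χ ⊗ₘ ω) := by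
  have hμ := tensorμ_natural_left (𝟙 H) Δ[H] U (V ⊗ W)
  simp only [id_tensorHom, id_whiskerRight] at hμ
  rw [comp_whiskerRight_assoc, reassoc_of% hμ]
  simp only [tensorAct, ← id_tensorHom, tensorHom_comp_tensorHom, Category.id_comp]

theorem intertwines_associator {U V W : 𝒞} (φ : H ⊗ U ⟶ U) (χ : H ⊗ V ⟶ V) (ω : H ⊗ W ⟶ W) :
    Intertwines (tensorAct (tensorAct φ χ) ω) (tensorAct φ (tensorAct χ ω)) (α_ U V W).hom := by
  have hcomul : (Δ[H] ≫ Δ[H] ▷ H) ▷ ((U ⊗ V) ⊗ W) ≫ ((α_ H H H).hom ⊗ₘ (α_ U V W).hom) =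
      H ◁ (α_ U V W).hom ≫ (Δ[H] ≫ H ◁ Δ[H]) ▷ (U ⊗ V ⊗ W) := by
    rw [ComonObj.comul_assoc, MonoidalCategory.tensorHom_def', ← whisker_exchange_assoc,
      ← comp_whiskerRight]
    simp only [Category.assoc]
  unfold Intertwines
  rw [tensorAct_tensorAct_left, tensorAct_tensorAct_right, ← reassoc_of% hcomul,
    ← reassoc_of% associator_monoidal H H H U V W, ← associator_naturality]
  simp only [Category.assoc]

theorem intertwines_leftUnitor {V : 𝒞} (φ : H ⊗ V ⟶ V) :
    Intertwines (tensorAct (unitAct H) φ) φ (λ_ V).hom := by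
  have hμ := tensorμ_natural_left ε[H] (𝟙 H) (𝟙_ 𝒞) V
  simp only [tensorHom_id, id_whiskerRight] at hμ
  unfold Intertwines tensorAct unitAct
  calc
    _ = Δ[H] ▷ (𝟙_ 𝒞 ⊗ V) ≫ ε[H] ▷ H ▷ (𝟙_ 𝒞 ⊗ V) ≫ (tensorμ (𝟙_ 𝒞) H (𝟙_ 𝒞) V ≫
        (λ_ (𝟙_ 𝒞)).hom ▷ (H ⊗ V) ≫ (λ_ (H ⊗ V)).hom) ≫ φ := by
      simp only [Category.assoc, reassoc_of% hμ]
      rw [← leftUnitor_naturality]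
      simp only [← tensorHom_id, ← id_tensorHom, tensorHom_comp_tensorHom_assoc, Category.id_comp,
        Category.comp_id]
    _ = _ := by
      rw [← leftUnitor_monoidal, ← comp_whiskerRight_assoc, ComonObj.counit_comul,
        MonoidalCategory.tensorHom_def]
      simp

theorem intertwines_rightUnitor {V : 𝒞} (φ : H ⊗ V ⟶ V) :
    Intertwines (tensorAct φ (unitAct H)) φ (ρ_ V).hom := by
  have hμ := tensorμ_natural_left (𝟙 H) ε[H] V (𝟙_ 𝒞)
  simp only [id_tensorHom, id_whiskerRight] at hμ
  unfold Intertwines tensorAct unitAct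
  calc
    _ = Δ[H] ▷ (V ⊗ 𝟙_ 𝒞) ≫ (H ◁ ε[H]) ▷ (V ⊗ 𝟙_ 𝒞) ≫ (tensorμ H (𝟙_ 𝒞) V (𝟙_ 𝒞) ≫
        (H ⊗ V) ◁ (λ_ (𝟙_ 𝒞)).hom ≫ (ρ_ (H ⊗ V)).hom) ≫ φ := by
      simp only [Category.assoc, reassoc_of% hμ]
      rw [← rightUnitor_naturality]
      simp only [← tensorHom_id, ← id_tensorHom, tensorHom_comp_tensorHom_assoc, Category.id_comp,
        Category.comp_id]
    _ = _ := by
      rw [← rightUnitor_monoidal, ← comp_whiskerRight_assoc, ComonObj.comul_counit,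
        MonoidalCategory.tensorHom_def]
      simp

end ActionMaps

section Diag

variable {𝒞 : Type u} [Category.{v} 𝒞] [MonoidalCategory 𝒞] [BraidedCategory 𝒞]
variable (H C : 𝒞) [HopfObj H] [ModObj H C]

theorem diagAct_zero : diagAct H C 0 = unitAct H := by
  simp [diagAct, unitAct, iterComul, tpowShuffle, tpowMap, tpow]

theorem diagAct_succ (n : ℕ) :
    diagAct H C (n + 1) = tensorAct γ[H, C] (diagAct H C n) := by
  simp only [diagAct, tensorAct, iterComul, tpowShuffle, tpowMap, tpow]
  have hμ := tensorμ_natural_left (𝟙 H) (iterComul H n) C (tpow C n)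
  simp only [id_tensorHom, id_whiskerRight] at hμ
  simp only [comp_whiskerRight, Category.assoc, reassoc_of% hμ]
  simp only [← id_tensorHom, tensorHom_comp_tensorHom, Category.id_comp]

theorem intertwines_tpowSnoc (n : ℕ) :
    Intertwines (tensorAct (diagAct H C n) γ[H, C]) (diagAct H C (n + 1))
      (tpowSnoc C n).hom := by
  induction n with
  | zero =>
    rw [diagAct_succ, diagAct_zero]
    exact (intertwines_leftUnitor _).comp ((intertwines_rightUnitor _).iso_inv)
  | succ n ih =>
    rw [diagAct_succ H C (n + 1)]
    have hassoc := intertwines_associator γ[H, C] (diagAct H C n) γ[H, C]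
    rw [← diagAct_succ] at hassoc
    exact hassoc.comp (ih.whiskerLeft _)

end Diag

section ModCoalg

variable {𝒞 : Type u} [Category.{v} 𝒞] [MonoidalCategory 𝒞] [BraidedCategory 𝒞]
variable (H C : 𝒞) [HopfObj H] [ModuleCoalgObj H C]

theorem intertwines_comul :
    Intertwines γ[H, C] (tensorAct γ[H, C] γ[H, C]) Δ[C] := by
  unfold Intertwines tensorAct
  rw [ModuleCoalgObj.smul_comul, tensorHom_def', Category.assoc]

theorem intertwines_counit : Intertwines γ[H, C] (unitAct H) ε[C] := by
  unfold Intertwines unitAct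
  rw [ModuleCoalgObj.smul_counit, tensorHom_def', Category.assoc]

theorem intertwines_comulAt (n : ℕ) (i : Fin n) :
    Intertwines (diagAct H C n) (diagAct H C (n + 1)) (comulAt C n i) := by
  induction n with
  | zero => exact i.elim0
  | succ n ih =>
    rw [diagAct_succ H C (n + 1)]
    induction i using Fin.cases with
    | zero =>
      rw [diagAct_succ H C n]
      exact ((intertwines_comul H C).whiskerRight _).comp (intertwines_associator _ _ _)
    | succ i =>
      nth_rewrite 1 [diagAct_succ H C n]
      exact (ih i).whiskerLeft _

theorem intertwines_counitAt (n : ℕ) (i : Fin (n + 1)) :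
    Intertwines (diagAct H C (n + 1)) (diagAct H C n) (counitAt C n i) := by
  induction n with
  | zero =>
    rw [diagAct_succ]
    exact ((intertwines_counit H C).whiskerRight _).comp (intertwines_leftUnitor _)
  | succ n ih =>
    rw [diagAct_succ H C (n + 1)]
    induction i using Fin.cases with
    | zero =>
      exact ((intertwines_counit H C).whiskerRight _).comp (intertwines_leftUnitor _)
    | succ i =>
      nth_rewrite 2 [diagAct_succ H C n]
      exact (ih i).whiskerLeft _

end ModCoalg

section Coaction

variable {𝒞 : Type u} [Category.{v} 𝒞] [MonoidalCategory 𝒞] [BraidedCategory 𝒞]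

section

variable (H M : 𝒞) [ComonObj H] [LeftComodObj H M]

/-- The left coaction moved to the right by the braiding, `m ↦ m₍₀₎ ⊗ m₍₋₁₎`. -/
def rightCoact : M ⟶ M ⊗ H := LeftComodObj.coact ≫ (β_ H M).hom

theorem rightCoact_comp_counit : rightCoact H M ≫ M ◁ ε[H] = (ρ_ M).inv := by
  rw [rightCoact, Category.assoc, ← braiding_naturality_left, braiding_tensorUnit_left,
    reassoc_of% LeftComodObj.counit_coact (H := H) (M := M), Iso.inv_hom_id_assoc]

theorem rightCoact_comp_rightCoact :
    rightCoact H M ≫ rightCoact H M ▷ H ≫ (α_ M H H).hom =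
      rightCoact H M ≫ M ◁ (Δ[H] ≫ (β_ H H).hom) := by
  have hcomul := LeftComodObj.comul_coact (H := H) (M := M)
  unfold rightCoact
  set c := (LeftComodObj.coact : M ⟶ H ⊗ M)
  calc
    _ = c ≫ ((β_ H M).hom ≫ c ▷ H) ⊗≫ (β_ H M).hom ▷ H ⊗≫ 𝟙 _ := by monoidal
    _ = (c ≫ H ◁ c ≫ (α_ H H M).inv) ⊗≫ (β_ H H).hom ▷ M ⊗≫ H ◁ (β_ H M).hom ⊗≫
        (β_ H M).hom ▷ H ⊗≫ 𝟙 _ := by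
      rw [← braiding_naturality_right, braiding_tensor_right_hom]; monoidal
    _ = c ≫ ((Δ[H] ≫ (β_ H H).hom) ▷ M ≫ (β_ (H ⊗ H) M).hom) := by
      rw [← hcomul, braiding_tensor_left_hom]; monoidal
    _ = _ := by rw [braiding_naturality_left, Category.assoc]

end

section

variable {H : 𝒞} [ComonObj H] (M : 𝒞) [LeftComodObj H M]

/-- The map `m ⊗ v ↦ m₍₀₎ ⊗ f (m₍₋₁₎ ⊗ v)`. -/
def coactMap {V W : 𝒞} (f : H ⊗ V ⟶ W) : M ⊗ V ⟶ M ⊗ W :=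
  rightCoact H M ▷ V ≫ (α_ M H V).hom ≫ M ◁ f

theorem whiskerLeft_comp_coactMap {V V' W : 𝒞} (g : V ⟶ V') (f : H ⊗ V' ⟶ W) :
    M ◁ g ≫ coactMap M f = coactMap M (H ◁ g ≫ f) := by
  rw [coactMap, coactMap, whisker_exchange_assoc, associator_naturality_right_assoc,
    whiskerLeft_comp]

theorem coactMap_comp_whiskerLeft {V W W' : 𝒞} (f : H ⊗ V ⟶ W) (g : W ⟶ W') :
    coactMap M f ≫ M ◁ g = coactMap M (f ≫ g) := by
  simp only [coactMap, Category.assoc, whiskerLeft_comp]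

theorem coactMap_counit (V : 𝒞) : coactMap M (ε[H] ▷ V ≫ (λ_ V).hom) = 𝟙 (M ⊗ V) := by
  calc
    _ = (rightCoact H M ≫ M ◁ ε[H]) ▷ V ⊗≫ 𝟙 _ := by unfold coactMap; monoidal
    _ = _ := by rw [rightCoact_comp_counit]; monoidal

/-- The map `h ⊗ v ↦ g (h⁽²⁾ ⊗ f (h⁽¹⁾ ⊗ v))`, which is the composition in the co-Kleisli
category of `H ⊗ -` for the opposite comultiplication of `H`. -/
def cokleisliComp {V W Z : 𝒞} (f : H ⊗ V ⟶ W) (g : H ⊗ W ⟶ Z) : H ⊗ V ⟶ Z :=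
  (Δ[H] ≫ (β_ H H).hom) ▷ V ≫ (α_ H H V).hom ≫ H ◁ f ≫ g

theorem coactMap_comp_coactMap {V W Z : 𝒞} (f : H ⊗ V ⟶ W) (g : H ⊗ W ⟶ Z) :
    coactMap M f ≫ coactMap M g = coactMap M (cokleisliComp f g) := by
  have hexch : M ◁ f ≫ rightCoact H M ▷ W = rightCoact H M ▷ (H ⊗ V) ≫ (M ⊗ H) ◁ f :=
    whisker_exchange _ _
  unfold coactMap cokleisliComp
  calc
    _ = rightCoact H M ▷ V ≫ (α_ M H V).hom ≫ (M ◁ f ≫ rightCoact H M ▷ W) ⊗≫ M ◁ g := by monoidal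
    _ = (rightCoact H M ≫ rightCoact H M ▷ H ≫ (α_ M H H).hom) ▷ V ⊗≫ M ◁ (H ◁ f ≫ g) := by
      rw [hexch]; monoidal
    _ = _ := by rw [rightCoact_comp_rightCoact]; monoidal

end

end Coaction

section Rotation

variable {𝒞 : Type u} [Category.{v} 𝒞] [MonoidalCategory 𝒞]

section

variable [BraidedCategory 𝒞] {H : 𝒞}

/-- The map `h ⊗ v ⊗ x ↦ x ⊗ h v`. -/
def rotate {V : 𝒞} (φ : H ⊗ V ⟶ V) (X : 𝒞) : H ⊗ (V ⊗ X) ⟶ X ⊗ V :=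
  (α_ H V X).inv ≫ φ ▷ X ≫ (β_ V X).hom

theorem rotate_naturality_right {V X Y : 𝒞} (φ : H ⊗ V ⟶ V) (f : X ⟶ Y) :
    H ◁ (V ◁ f) ≫ rotate φ Y = rotate φ X ≫ f ▷ V := by
  simp only [rotate, Category.assoc, associator_inv_naturality_right_assoc,
    whisker_exchange_assoc, braiding_naturality_right]

theorem Intertwines.rotate_naturality_left {V W : 𝒞} {φ : H ⊗ V ⟶ V} {χ : H ⊗ W ⟶ W}
    {f : V ⟶ W} (hf : Intertwines φ χ f) (X : 𝒞) :
    H ◁ (f ▷ X) ≫ rotate χ X = rotate φ X ≫ X ◁ f := by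
  unfold Intertwines at hf
  rw [rotate, rotate, associator_inv_naturality_middle_assoc, ← comp_whiskerRight_assoc, ← hf,
    comp_whiskerRight_assoc, Category.assoc, Category.assoc, braiding_naturality_left]

theorem rotate_tensorUnit {V : 𝒞} (φ : H ⊗ V ⟶ V) :
    rotate φ (𝟙_ 𝒞) = H ◁ (ρ_ V).hom ≫ φ ≫ (λ_ V).inv := by
  rw [rotate, braiding_tensorUnit_right]
  monoidal

theorem rotate_unitAct [ComonObj H] (X : 𝒞) :
    rotate (unitAct H) X = ε[H] ▷ (𝟙_ 𝒞 ⊗ X) ≫ (λ_ (𝟙_ 𝒞 ⊗ X)).hom ≫ (λ_ X).hom ≫ (ρ_ X).inv := by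
  rw [rotate, unitAct, braiding_tensorUnit_left]
  monoidal

end

section

variable [SymmetricCategory 𝒞]

theorem braiding_comp_braiding (V W Y : 𝒞) :
    (β_ V (W ⊗ Y)).hom ≫ (α_ W Y V).hom ≫ (β_ W (Y ⊗ V)).hom =
      (α_ V W Y).inv ≫ (β_ (V ⊗ W) Y).hom ≫ (α_ Y V W).inv := by
  have hs : (β_ V W).hom ▷ Y ≫ (β_ W V).hom ▷ Y = 𝟙 _ := by
    rw [← comp_whiskerRight, SymmetricCategory.symmetry, id_whiskerRight]
  calc
    _ = 𝟙 _ ⊗≫ (β_ V W).hom ▷ Y ⊗≫ (W ◁ (β_ V Y).hom ≫ (β_ W (Y ⊗ V)).hom) := by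
      rw [braiding_tensor_right_hom V W Y]; monoidal
    _ = 𝟙 _ ⊗≫ ((β_ V W).hom ▷ Y ≫ (β_ W V).hom ▷ Y) ⊗≫ V ◁ (β_ W Y).hom ⊗≫
        (β_ V Y).hom ▷ W := by
      rw [braiding_naturality_right, braiding_tensor_right_hom W V Y]; monoidal
    _ = _ := by rw [hs, braiding_tensor_left_hom]; monoidal

theorem braiding_comp_whiskerLeft_comp_braiding {H V W : 𝒞} (φ : H ⊗ V ⟶ W) :
    (β_ H H).hom ▷ V ≫ (α_ H H V).hom ≫ H ◁ φ ≫ (β_ H W).hom =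
      (α_ H H V).hom ≫ H ◁ (β_ H V).hom ≫ (α_ H V H).inv ≫ φ ▷ H := by
  have hs : (β_ H H).hom ▷ V ≫ (β_ H H).hom ▷ V = 𝟙 _ := by
    rw [← comp_whiskerRight, SymmetricCategory.symmetry, id_whiskerRight]
  rw [braiding_naturality_right, braiding_tensor_right_hom]
  simp only [Category.assoc, Iso.hom_inv_id_assoc, reassoc_of% hs]

theorem cokleisliComp_rotate {H : 𝒞} [ComonObj H] {V W : 𝒞} (φ : H ⊗ V ⟶ V) (χ : H ⊗ W ⟶ W)
    (X : 𝒞) :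
    cokleisliComp (rotate φ (W ⊗ X) ≫ (α_ W X V).hom) (rotate χ (X ⊗ V)) =
      H ◁ (α_ V W X).inv ≫ rotate (tensorAct φ χ) X ≫ (α_ X V W).inv := by
  have hs : (β_ H V).hom ▷ (W ⊗ X) ≫ (β_ V H).hom ▷ (W ⊗ X) = 𝟙 _ := by
    rw [← comp_whiskerRight, SymmetricCategory.symmetry, id_whiskerRight]
  have hφ := braiding_comp_whiskerLeft_comp_braiding φ
  unfold cokleisliComp rotate tensorAct tensorμ
  calc
    _ = Δ[H] ▷ (V ⊗ W ⊗ X) ⊗≫ (β_ H H).hom ▷ (V ⊗ W ⊗ X) ⊗≫ H ◁ φ ▷ (W ⊗ X) ⊗≫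
        ((β_ H V).hom ▷ (W ⊗ X) ≫ (β_ V H).hom ▷ (W ⊗ X)) ⊗≫ H ◁ (β_ V (W ⊗ X)).hom ⊗≫
        χ ▷ (X ⊗ V) ≫ (β_ W (X ⊗ V)).hom := by
      rw [hs]; monoidal
    _ = Δ[H] ▷ (V ⊗ W ⊗ X) ⊗≫ ((β_ H H).hom ▷ V ≫ (α_ H H V).hom ≫ H ◁ φ ≫ (β_ H V).hom) ▷
        (W ⊗ X) ⊗≫ ((β_ V (H ⊗ W ⊗ X)).hom ≫ ((α_ H W X).inv ≫ χ ▷ X) ▷ V) ⊗≫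
        (β_ W (X ⊗ V)).hom := by
      rw [braiding_tensor_right_hom V H (W ⊗ X)]; monoidal
    _ = Δ[H] ▷ (V ⊗ W ⊗ X) ⊗≫ H ◁ (β_ H V).hom ▷ (W ⊗ X) ⊗≫ φ ▷ (H ⊗ W ⊗ X) ⊗≫
        V ◁ χ ▷ X ⊗≫ ((β_ V (W ⊗ X)).hom ≫ (α_ W X V).hom ≫ (β_ W (X ⊗ V)).hom) := by
      rw [hφ, ← braiding_naturality_right]; monoidal
    _ = _ := by
      rw [braiding_comp_braiding, MonoidalCategory.tensorHom_def]; monoidal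

end

end Rotation

section PushAct

variable {𝒞 : Type u} [Category.{v} 𝒞] [MonoidalCategory 𝒞] [BraidedCategory 𝒞]
variable {H : 𝒞} [ComonObj H] {V : 𝒞}

/-- The map `h ⊗ v ↦ h⁽¹⁾ v ⊗ h⁽²⁾`. -/
def pushAct (φ : H ⊗ V ⟶ V) : H ⊗ V ⟶ V ⊗ H :=
  Δ[H] ▷ V ≫ (α_ H H V).hom ≫ H ◁ (β_ H V).hom ≫ (α_ H V H).inv ≫ φ ▷ H

theorem tensorAct_eq_pushAct {W : 𝒞} (φ : H ⊗ V ⟶ V) (χ : H ⊗ W ⟶ W) :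
    tensorAct φ χ = (α_ H V W).inv ≫ pushAct φ ▷ W ≫ (α_ V H W).hom ≫ V ◁ χ := by
  unfold tensorAct pushAct tensorμ
  rw [MonoidalCategory.tensorHom_def]
  monoidal

theorem pushAct_comp_counit (φ : H ⊗ V ⟶ V) : pushAct φ ≫ V ◁ ε[H] = φ ≫ (ρ_ V).inv := by
  have hε : (β_ H V).hom ≫ V ◁ ε[H] = ε[H] ▷ V ≫ (λ_ V).hom ≫ (ρ_ V).inv := by
    rw [← braiding_naturality_left, braiding_tensorUnit_left]
  unfold pushAct
  calc
    _ = 𝟙 _ ⊗≫ Δ[H] ▷ V ⊗≫ H ◁ (β_ H V).hom ⊗≫ (φ ▷ H ≫ V ◁ ε[H]) := by monoidal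
    _ = 𝟙 _ ⊗≫ Δ[H] ▷ V ⊗≫ H ◁ ((β_ H V).hom ≫ V ◁ ε[H]) ⊗≫ φ ▷ 𝟙_ 𝒞 := by
      rw [← whisker_exchange]; monoidal
    _ = 𝟙 _ ⊗≫ (Δ[H] ≫ H ◁ ε[H]) ▷ V ⊗≫ φ ▷ 𝟙_ 𝒞 := by
      rw [hε]; monoidal
    _ = _ := by rw [ComonObj.comul_counit]; monoidal

theorem pushAct_comp_comul (φ : H ⊗ V ⟶ V) :
    pushAct φ ≫ V ◁ Δ[H] =
      Δ[H] ▷ V ≫ (α_ H H V).hom ≫ H ◁ (β_ H V).hom ≫ (α_ H V H).inv ≫ pushAct φ ▷ H ≫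
        (α_ V H H).hom := by
  unfold pushAct
  calc
    _ = 𝟙 _ ⊗≫ Δ[H] ▷ V ⊗≫ H ◁ (β_ H V).hom ⊗≫ (φ ▷ H ≫ V ◁ Δ[H]) := by monoidal
    _ = 𝟙 _ ⊗≫ Δ[H] ▷ V ⊗≫ H ◁ ((β_ H V).hom ≫ V ◁ Δ[H]) ⊗≫ φ ▷ (H ⊗ H) := by
      rw [← whisker_exchange]; monoidal
    _ = 𝟙 _ ⊗≫ (Δ[H] ≫ H ◁ Δ[H]) ▷ V ⊗≫ (H ⊗ H) ◁ (β_ H V).hom ⊗≫ H ◁ (β_ H V).hom ▷ H ⊗≫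
        φ ▷ (H ⊗ H) := by
      rw [← braiding_naturality_left, braiding_tensor_left_hom]; monoidal
    _ = 𝟙 _ ⊗≫ Δ[H] ▷ V ⊗≫ (Δ[H] ▷ (H ⊗ V) ≫ (H ⊗ H) ◁ (β_ H V).hom) ⊗≫
        H ◁ (β_ H V).hom ▷ H ⊗≫ φ ▷ (H ⊗ H) := by
      rw [ComonObj.comul_assoc H]; monoidal
    _ = _ := by rw [← whisker_exchange]; monoidal

end PushAct

section Antipode

variable {𝒞 : Type u} [Category.{v} 𝒞] [MonoidalCategory 𝒞] [BraidedCategory 𝒞]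
variable {H : 𝒞} [HopfObj H] {V : 𝒞}

/-- The map `h ⊗ v ↦ h⁽¹⁾ ⊗ S(h⁽²⁾) v`. -/
def antipodeAct (φ : H ⊗ V ⟶ V) : H ⊗ V ⟶ H ⊗ V :=
  Δ[H] ▷ V ≫ (α_ H H V).hom ≫ H ◁ (𝒮[H] ▷ V ≫ φ)

theorem antipodeAct_comp_smul [ModObj H V] :
    antipodeAct γ[H, V] ≫ γ[H, V] = ε[H] ▷ V ≫ (λ_ V).hom := by
  unfold antipodeAct
  calc
    _ = (Δ[H] ≫ H ◁ 𝒮[H]) ▷ V ≫ (α_ H H V).hom ≫ H ◁ γ[H, V] ≫ γ[H, V] := by monoidal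
    _ = (Δ[H] ≫ H ◁ 𝒮[H] ≫ μ[H]) ▷ V ≫ γ[H, V] := by
      rw [← ModObj.mul_smul_self]; simp only [comp_whiskerRight, Category.assoc]
    _ = _ := by rw [HopfObj.antipode_right, comp_whiskerRight_assoc, ModObj.one_smul_self]

theorem antipode_tensor_mul_comp_mul_comp_smul [ModObj H V] :
    ((𝒮[H] ⊗ₘ μ[H]) ≫ μ[H]) ▷ V ≫ γ[H, V] =
      𝟙 _ ⊗≫ H ◁ (H ◁ γ[H, V] ≫ γ[H, V]) ⊗≫ (𝒮[H] ▷ V ≫ γ[H, V]) := by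
  have hmul : μ[H] ▷ V ≫ γ[H, V] = (α_ H H V).hom ≫ H ◁ γ[H, V] ≫ γ[H, V] :=
    ModObj.mul_smul_self H V
  calc
    _ = (𝒮[H] ⊗ₘ μ[H]) ▷ V ≫ μ[H] ▷ V ≫ γ[H, V] := by rw [comp_whiskerRight, Category.assoc]
    _ = 𝟙 _ ⊗≫ (𝒮[H] ▷ ((H ⊗ H) ⊗ V) ≫ H ◁ (μ[H] ▷ V ≫ γ[H, V])) ⊗≫ γ[H, V] := by
      nth_rewrite 1 [hmul]
      rw [MonoidalCategory.tensorHom_def]; monoidal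
    _ = _ := by rw [hmul, ← whisker_exchange]; monoidal

/-- The map `k ⊗ h ⊗ v ↦ h⁽²⁾ ⊗ S(h⁽³⁾) k h⁽¹⁾ v`. -/
def antipodeConj (φ : H ⊗ V ⟶ V) : H ⊗ (H ⊗ V) ⟶ H ⊗ V :=
  H ◁ pushAct φ ≫ (α_ H V H).inv ≫ φ ▷ H ≫ (β_ V H).hom ≫ antipodeAct φ

-- On elements: `h⁽¹⁾ x ⊗ h⁽²⁾ S(h⁽³⁾) v = h x ⊗ v`.
theorem antipodeAct_comp_tensorAct [ModObj H V] {X : 𝒞} (χ : H ⊗ X ⟶ X) :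
    (β_ V H).hom ▷ X ≫ antipodeAct γ[H, V] ▷ X ≫ (α_ H V X).hom ≫ H ◁ (β_ V X).hom ≫
      tensorAct χ γ[H, V] =
    (α_ V H X).hom ≫ V ◁ χ ≫ (β_ V X).hom := by
  have hS := antipodeAct_comp_smul (H := H) (V := V)
  have hΔ := pushAct_comp_comul χ
  have hε := pushAct_comp_counit χ
  rw [tensorAct_eq_pushAct]
  unfold antipodeAct at hS ⊢
  set s := 𝒮[H] ▷ V ≫ γ[H, V]
  calc
    _ = (β_ V H).hom ▷ X ⊗≫ Δ[H] ▷ (V ⊗ X) ⊗≫ H ◁ (s ▷ X ≫ (β_ V X).hom) ⊗≫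
        pushAct χ ▷ V ⊗≫ X ◁ γ[H, V] := by monoidal
    _ = (β_ V H).hom ▷ X ⊗≫ (Δ[H] ▷ (V ⊗ X) ≫ (H ⊗ H) ◁ (β_ V X).hom) ⊗≫
        H ◁ (β_ H X).hom ▷ V ⊗≫ ((H ⊗ X) ◁ s ≫ pushAct χ ▷ V) ⊗≫ X ◁ γ[H, V] := by
      rw [braiding_naturality_left, braiding_tensor_left_hom]; monoidal
    _ = (β_ V H).hom ▷ X ⊗≫ H ◁ (β_ V X).hom ⊗≫
        (Δ[H] ▷ X ≫ (α_ H H X).hom ≫ H ◁ (β_ H X).hom ≫ (α_ H X H).inv ≫ pushAct χ ▷ H ≫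
          (α_ X H H).hom) ▷ V ⊗≫ X ◁ H ◁ s ⊗≫ X ◁ γ[H, V] := by
      rw [whisker_exchange, ← whisker_exchange]; monoidal
    _ = (β_ V H).hom ▷ X ⊗≫ H ◁ (β_ V X).hom ⊗≫ pushAct χ ▷ V ⊗≫
        X ◁ ((Δ[H] ▷ V ≫ (α_ H H V).hom ≫ H ◁ s) ≫ γ[H, V]) ⊗≫ 𝟙 _ := by
      rw [← hΔ]; monoidal
    _ = (β_ V H).hom ▷ X ⊗≫ H ◁ (β_ V X).hom ⊗≫ (pushAct χ ≫ X ◁ ε[H]) ▷ V ⊗≫ 𝟙 _ := by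
      rw [hS]; monoidal
    _ = 𝟙 _ ⊗≫ ((β_ V (H ⊗ X)).hom ≫ χ ▷ V) ⊗≫ 𝟙 _ := by
      rw [hε, braiding_tensor_right_hom]; monoidal
    _ = _ := by rw [← braiding_naturality_right]; monoidal

-- On elements: `h⁽²⁾ x ⊗ h⁽³⁾ S(h⁽⁴⁾) k h⁽¹⁾ v = h⁽²⁾ x ⊗ k h⁽¹⁾ v`.
theorem antipodeConj_comp_tensorAct [ModObj H V] {X : 𝒞} (χ : H ⊗ X ⟶ X) :
    (α_ H (H ⊗ V) X).inv ≫ antipodeConj γ[H, V] ▷ X ≫ (α_ H V X).hom ≫ H ◁ (β_ V X).hom ≫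
      tensorAct χ γ[H, V] =
    H ◁ ((α_ H V X).hom ≫ tensorAct γ[H, V] χ) ≫ rotate γ[H, V] X := by
  have hχ := antipodeAct_comp_tensorAct (V := V) χ
  rw [tensorAct_eq_pushAct γ[H, V] χ]
  unfold antipodeConj rotate
  set φ : H ⊗ V ⟶ V := γ[H, V]
  calc
    _ = 𝟙 _ ⊗≫ H ◁ pushAct φ ▷ X ⊗≫ φ ▷ H ▷ X ⊗≫ ((β_ V H).hom ▷ X ≫
        antipodeAct φ ▷ X ≫ (α_ H V X).hom ≫ H ◁ (β_ V X).hom ≫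
        tensorAct χ φ) := by monoidal
    _ = 𝟙 _ ⊗≫ H ◁ pushAct φ ▷ X ⊗≫ (φ ▷ (H ⊗ X) ≫ V ◁ χ) ⊗≫ (β_ V X).hom := by
      rw [hχ]; monoidal
    _ = _ := by rw [← whisker_exchange]; monoidal

end Antipode

section SAYD

variable {𝒞 : Type u} [Category.{v} 𝒞] [MonoidalCategory 𝒞] [SymmetricCategory 𝒞]

theorem whiskerLeft_braiding_comp_whiskerRight_braiding_comp_braiding (M C D : 𝒞) :
    M ◁ (β_ C D).hom ⊗≫ (β_ M D).hom ▷ C ⊗≫ (β_ D (M ⊗ C)).hom = (α_ M C D).inv := by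
  have hMD : (β_ M D).hom ▷ C ≫ (β_ D M).hom ▷ C = 𝟙 _ := by
    rw [← comp_whiskerRight, SymmetricCategory.symmetry, id_whiskerRight]
  have hCD : M ◁ (β_ C D).hom ≫ M ◁ (β_ D C).hom = 𝟙 _ := by
    rw [← whiskerLeft_comp, SymmetricCategory.symmetry, whiskerLeft_id]
  calc
    _ = M ◁ (β_ C D).hom ⊗≫ ((β_ M D).hom ▷ C ≫ (β_ D M).hom ▷ C) ⊗≫ M ◁ (β_ D C).hom ⊗≫
        𝟙 _ := by rw [braiding_tensor_right_hom]; monoidal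
    _ = (M ◁ (β_ C D).hom ≫ M ◁ (β_ D C).hom) ⊗≫ 𝟙 _ := by rw [hMD]; monoidal
    _ = _ := by rw [hCD]; monoidal

theorem anti_yetter_drinfeld_permutation (A M B C D : 𝒞) :
    A ◁ (β_ M B).hom ▷ (C ⊗ D) ⊗≫ (A ⊗ B ⊗ M) ◁ (β_ C D).hom ⊗≫
      (A ⊗ B) ◁ (β_ M D).hom ▷ C ⊗≫ (β_ (A ⊗ B) D).hom ▷ (M ⊗ C) ⊗≫
      (β_ (D ⊗ A ⊗ B) (M ⊗ C)).hom =
    𝟙 _ ⊗≫ (β_ A M).hom ▷ (B ⊗ C ⊗ D) ⊗≫ M ◁ (β_ (A ⊗ B) (C ⊗ D)).hom ⊗≫ 𝟙 _ := by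
  have hMB : A ◁ (β_ M B).hom ≫ A ◁ (β_ B M).hom = 𝟙 _ := by
    rw [← whiskerLeft_comp, SymmetricCategory.symmetry, whiskerLeft_id]
  calc
    _ = A ◁ (β_ M B).hom ▷ (C ⊗ D) ⊗≫ (A ⊗ B ⊗ M) ◁ (β_ C D).hom ⊗≫
        (A ⊗ B) ◁ (β_ M D).hom ▷ C ⊗≫
        ((β_ (A ⊗ B) (D ⊗ M ⊗ C)).hom ≫ (β_ D (M ⊗ C)).hom ▷ (A ⊗ B)) ⊗≫ 𝟙 _ := by
      rw [braiding_tensor_left_hom D (A ⊗ B) (M ⊗ C), braiding_tensor_right_hom (A ⊗ B) D (M ⊗ C)]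
      monoidal
    _ = A ◁ (β_ M B).hom ▷ (C ⊗ D) ⊗≫ (A ⊗ B) ◁ (M ◁ (β_ C D).hom ⊗≫
        (β_ M D).hom ▷ C ⊗≫ (β_ D (M ⊗ C)).hom) ⊗≫
        (β_ (A ⊗ B) ((M ⊗ C) ⊗ D)).hom ⊗≫ 𝟙 _ := by
      rw [← braiding_naturality_right]; monoidal
    _ = A ◁ (β_ M B).hom ▷ (C ⊗ D) ⊗≫ ((A ⊗ B) ◁ (α_ M C D).inv ≫
        (β_ (A ⊗ B) ((M ⊗ C) ⊗ D)).hom) ⊗≫ 𝟙 _ := by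
      rw [whiskerLeft_braiding_comp_whiskerRight_braiding_comp_braiding]; monoidal
    _ = 𝟙 _ ⊗≫ (A ◁ (β_ M B).hom ≫ A ◁ (β_ B M).hom) ▷ (C ⊗ D) ⊗≫
        (β_ A M).hom ▷ (B ⊗ C ⊗ D) ⊗≫ M ◁ (β_ (A ⊗ B) (C ⊗ D)).hom ⊗≫ 𝟙 _ := by
      rw [braiding_naturality_right, braiding_tensor_right_hom (A ⊗ B) M (C ⊗ D),
        braiding_tensor_left_hom A B M]
      monoidal
    _ = _ := by rw [hMB]; monoidal

theorem antipodeConj_eq {H : 𝒞} [HopfObj H] {V : 𝒞} (φ : H ⊗ V ⟶ V) :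
    antipodeConj φ =
      H ◁ (Δ[H] ≫ H ◁ Δ[H]) ▷ V ⊗≫ (β_ (H ⊗ H) (H ⊗ H)).hom ▷ V ⊗≫
        (H ⊗ H) ◁ (H ◁ φ ≫ φ) ⊗≫ H ◁ (𝒮[H] ▷ V ≫ φ) := by
  have hs : (β_ (H ⊗ H) V).hom ≫ (β_ V (H ⊗ H)).hom = 𝟙 _ := SymmetricCategory.symmetry _ _
  have hα : (β_ (H ⊗ H ⊗ V) (H ⊗ H)).hom =
      (α_ H H V).inv ▷ (H ⊗ H) ≫ (β_ ((H ⊗ H) ⊗ V) (H ⊗ H)).hom ≫ (H ⊗ H) ◁ (α_ H H V).hom := by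
    rw [← braiding_naturality_left, ← comp_whiskerRight_assoc, Iso.inv_hom_id, id_whiskerRight,
      Category.id_comp]
  unfold antipodeConj pushAct antipodeAct
  calc
    _ = H ◁ Δ[H] ▷ V ⊗≫ H ◁ H ◁ (β_ H V).hom ⊗≫ ((H ◁ φ ≫ φ) ▷ H ≫ (β_ V H).hom) ⊗≫
        Δ[H] ▷ V ⊗≫ H ◁ (𝒮[H] ▷ V ≫ φ) := by monoidal
    _ = H ◁ Δ[H] ▷ V ⊗≫ H ◁ H ◁ (β_ H V).hom ⊗≫ (β_ (H ⊗ H ⊗ V) H).hom ⊗≫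
        (H ◁ (H ◁ φ ≫ φ) ≫ Δ[H] ▷ V) ⊗≫ H ◁ (𝒮[H] ▷ V ≫ φ) := by
      rw [braiding_naturality_left]; monoidal
    _ = H ◁ Δ[H] ▷ V ⊗≫ H ◁ H ◁ (β_ H V).hom ⊗≫ ((β_ (H ⊗ H ⊗ V) H).hom ≫
        Δ[H] ▷ (H ⊗ H ⊗ V)) ⊗≫ (H ⊗ H) ◁ (H ◁ φ ≫ φ) ⊗≫ H ◁ (𝒮[H] ▷ V ≫ φ) := by
      rw [whisker_exchange]; monoidal
    _ = H ◁ Δ[H] ▷ V ⊗≫ H ◁ H ◁ ((β_ H V).hom ≫ V ◁ Δ[H]) ⊗≫ (β_ (H ⊗ H ⊗ V) (H ⊗ H)).hom ⊗≫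
        (H ⊗ H) ◁ (H ◁ φ ≫ φ) ⊗≫ H ◁ (𝒮[H] ▷ V ≫ φ) := by
      rw [← braiding_naturality_right]; monoidal
    _ = H ◁ (Δ[H] ≫ H ◁ Δ[H]) ▷ V ⊗≫ H ◁ H ◁ ((β_ (H ⊗ H) V).hom ≫ (β_ V (H ⊗ H)).hom) ⊗≫
        (β_ (H ⊗ H) (H ⊗ H)).hom ▷ V ⊗≫
        (H ⊗ H) ◁ (H ◁ φ ≫ φ) ⊗≫ H ◁ (𝒮[H] ▷ V ≫ φ) := by
      rw [← braiding_naturality_left, hα, braiding_tensor_left_hom (H ⊗ H) V (H ⊗ H)]; monoidal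
    _ = _ := by rw [hs]; monoidal

variable {H : 𝒞} [HopfObj H] (M : 𝒞) [SAYDObj H M]

theorem act_comp_rightCoact :
    (RightModObj.act : M ⊗ H ⟶ M) ≫ rightCoact H M =
      rightCoact H M ▷ H ⊗≫ M ◁ (H ◁ (Δ[H] ≫ H ◁ Δ[H])) ⊗≫
        M ◁ (β_ (H ⊗ H) (H ⊗ H)).hom ⊗≫
        ((RightModObj.act : M ⊗ H ⟶ M) ⊗ₘ ((𝒮[H] ⊗ₘ μ[H]) ≫ μ[H])) := by
  have hp := anti_yetter_drinfeld_permutation H M H H H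
  rw [rightCoact, reassoc_of% SAYDObj.anti_yetter_drinfeld (H := H) (M := M)]
  set c := (LeftComodObj.coact : M ⟶ H ⊗ M)
  set a := (RightModObj.act : M ⊗ H ⟶ M)
  calc
    _ = (c ⊗ₘ (Δ[H] ≫ H ◁ Δ[H])) ⊗≫
        H ◁ (β_ M H).hom ▷ (H ⊗ H) ⊗≫
        (H ⊗ H ⊗ M) ◁ (β_ H H).hom ⊗≫
        (H ⊗ H) ◁ (β_ M H).hom ▷ H ⊗≫
        (β_ (H ⊗ H) H).hom ▷ (M ⊗ H) ⊗≫
        ((((𝒮[H] ⊗ₘ μ[H]) ≫ μ[H]) ⊗ₘ a) ≫ (β_ H M).hom) := by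
      simp only [monoidalComp, Category.assoc]
    _ = (c ⊗ₘ (Δ[H] ≫ H ◁ Δ[H])) ⊗≫
        (H ◁ (β_ M H).hom ▷ (H ⊗ H) ⊗≫ (H ⊗ H ⊗ M) ◁ (β_ H H).hom ⊗≫
        (H ⊗ H) ◁ (β_ M H).hom ▷ H ⊗≫ (β_ (H ⊗ H) H).hom ▷ (M ⊗ H) ⊗≫
        (β_ (H ⊗ H ⊗ H) (M ⊗ H)).hom) ⊗≫ (a ⊗ₘ ((𝒮[H] ⊗ₘ μ[H]) ≫ μ[H])) := by
      rw [braiding_naturality]; monoidal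
    _ = c ▷ H ⊗≫ ((H ⊗ M) ◁ (Δ[H] ≫ H ◁ Δ[H]) ≫ (β_ H M).hom ▷ (H ⊗ H ⊗ H)) ⊗≫
        M ◁ (β_ (H ⊗ H) (H ⊗ H)).hom ⊗≫ (a ⊗ₘ ((𝒮[H] ⊗ₘ μ[H]) ≫ μ[H])) := by
      rw [hp, MonoidalCategory.tensorHom_def c]; monoidal
    _ = _ := by rw [whisker_exchange]; monoidal

theorem act_comp_coactMap_smul (V : 𝒞) [ModObj H V] :
    RightModObj.act ▷ V ≫ coactMap M γ[H, V] =
      (α_ M H V).hom ≫ coactMap M (antipodeConj γ[H, V]) ≫ (α_ M H V).inv ≫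
        RightModObj.act ▷ V := by
  rw [antipodeConj_eq]
  unfold coactMap
  set a := (RightModObj.act : M ⊗ H ⟶ M)
  symm
  calc
    _ = 𝟙 _ ⊗≫ rightCoact H M ▷ (H ⊗ V) ⊗≫ M ◁ (H ◁ (Δ[H] ≫ H ◁ Δ[H]) ▷ V) ⊗≫
        M ◁ (β_ (H ⊗ H) (H ⊗ H)).hom ▷ V ⊗≫ ((M ⊗ H) ◁ (𝟙 ((H ⊗ H ⊗ H) ⊗ V) ⊗≫
          H ◁ (H ◁ γ[H, V] ≫ γ[H, V]) ⊗≫ (𝒮[H] ▷ V ≫ γ[H, V])) ≫ a ▷ V) := by monoidal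
    _ = (rightCoact H M ▷ H ⊗≫ M ◁ (H ◁ (Δ[H] ≫ H ◁ Δ[H])) ⊗≫
          M ◁ (β_ (H ⊗ H) (H ⊗ H)).hom ⊗≫ (a ⊗ₘ ((𝒮[H] ⊗ₘ μ[H]) ≫ μ[H]))) ▷ V ⊗≫
          M ◁ γ[H, V] := by
      rw [whisker_exchange a, ← antipode_tensor_mul_comp_mul_comp_smul,
        MonoidalCategory.tensorHom_def a]
      monoidal
    _ = _ := by rw [← act_comp_rightCoact]; monoidal

end SAYD

section Balances

variable {𝒞 : Type u} [Category.{v} 𝒞] [MonoidalCategory 𝒞]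

section

variable {H : 𝒞} [MonObj H] {M : 𝒞} [RightModObj H M]

/-- `p` coequalizes the two actions of `H` on `M ⊗ W`. -/
def Balances {W Z : 𝒞} (φ : H ⊗ W ⟶ W) (p : M ⊗ W ⟶ Z) : Prop :=
  RightModObj.act ▷ W ≫ p = (α_ M H W).hom ≫ M ◁ φ ≫ p

theorem Balances.precomp {V W Z : 𝒞} {φ : H ⊗ V ⟶ V} {χ : H ⊗ W ⟶ W} {p : M ⊗ W ⟶ Z}
    (hp : Balances χ p) {f : V ⟶ W} (hf : Intertwines φ χ f) : Balances φ (M ◁ f ≫ p) := by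
  unfold Balances Intertwines at *
  rw [← whisker_exchange_assoc, hp, ← whiskerLeft_comp_assoc, hf]
  simp

end

section

variable [BraidedCategory 𝒞] {H : 𝒞} [HopfObj H] {M : 𝒞} [SAYDObj H M]

theorem Balances.coactMap_comp {V Z : 𝒞} {φ : H ⊗ V ⟶ V} {p : M ⊗ V ⟶ Z}
    (hp : Balances φ p) : coactMap M φ ≫ p = p := by
  unfold Balances at hp
  rw [coactMap, Category.assoc, Category.assoc, ← hp, ← comp_whiskerRight_assoc, rightCoact,
    Category.assoc, SAYDObj.stable, id_whiskerRight, Category.id_comp]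

end

section

variable [SymmetricCategory 𝒞] {H : 𝒞} [HopfObj H] {M : 𝒞} [SAYDObj H M]

theorem Balances.rotate {V X Z : 𝒞} [ModObj H V] {χ : H ⊗ X ⟶ X} {p : M ⊗ X ⊗ V ⟶ Z}
    (hp : Balances (tensorAct χ γ[H, V]) p) :
    Balances (tensorAct γ[H, V] χ) (coactMap M (rotate γ[H, V] X) ≫ p) := by
  unfold Balances at *
  have hact := act_comp_coactMap_smul (H := H) M V
  have hconj := antipodeConj_comp_tensorAct (V := V) χ
  set a := (RightModObj.act : M ⊗ H ⟶ M)
  have hrot : coactMap M (BraidedHopfCyclic.rotate γ[H, V] X) =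
      (α_ M V X).inv ≫ coactMap M γ[H, V] ▷ X ≫ (α_ M V X).hom ≫ M ◁ (β_ V X).hom := by
    unfold coactMap BraidedHopfCyclic.rotate
    monoidal
  calc
    _ = 𝟙 _ ⊗≫ (a ▷ V ≫ coactMap M γ[H, V]) ▷ X ⊗≫ M ◁ (β_ V X).hom ⊗≫ p := by
      rw [hrot]; monoidal
    _ = 𝟙 _ ⊗≫ coactMap M (antipodeConj γ[H, V]) ▷ X ⊗≫ (a ▷ (V ⊗ X) ≫ M ◁ (β_ V X).hom) ⊗≫
        p := by
      rw [hact]; monoidal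
    _ = 𝟙 _ ⊗≫ coactMap M (antipodeConj γ[H, V]) ▷ X ⊗≫ (M ⊗ H) ◁ (β_ V X).hom ⊗≫
        (a ▷ (X ⊗ V) ≫ p) := by
      rw [← whisker_exchange a]; monoidal
    _ = 𝟙 _ ⊗≫ coactMap M ((α_ H (H ⊗ V) X).inv ≫ antipodeConj γ[H, V] ▷ X ≫ (α_ H V X).hom ≫
        H ◁ (β_ V X).hom ≫ tensorAct χ γ[H, V]) ⊗≫ p := by
      rw [hp]; unfold coactMap; monoidal
    _ = _ := by rw [hconj, ← whiskerLeft_comp_coactMap]; monoidal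

end

end Balances

section TensorPowerIdentities

variable {𝒞 : Type u} [Category.{v} 𝒞] [MonoidalCategory 𝒞] (C : 𝒞)

section Append

/-- The coherence isomorphism `C ^ k ⊗ C ^ l ⟶ C ^ N` for `l + k = N`. The length `N` is kept
separate because `(l + 1) + k` and `l + (k + 1)` are not definitionally equal. -/
def tpowAppend : ∀ (k l : ℕ) {N : ℕ}, l + k = N → (tpow C k ⊗ tpow C l ⟶ tpow C N)
  | 0, l, _, rfl => (λ_ (tpow C l)).hom
  | k + 1, l, _, rfl => (α_ C (tpow C k) (tpow C l)).hom ≫ C ◁ tpowAppend k l rfl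

theorem tpowAppend_zero_left (l : ℕ) (h : l + 0 = l) :
    tpowAppend C 0 l h = (λ_ (tpow C l)).hom := rfl

theorem tpowAppend_succ_left (k l : ℕ) {N : ℕ} (h : l + k = N) (h' : l + (k + 1) = N + 1) :
    tpowAppend C (k + 1) l h' = (α_ C (tpow C k) (tpow C l)).hom ≫ C ◁ tpowAppend C k l h := by
  subst h
  rfl

theorem tpowAppend_zero_right (k : ℕ) (h : 0 + k = k) :
    tpowAppend C k 0 h = (ρ_ (tpow C k)).hom := by
  induction k with
  | zero => exact unitors_equal
  | succ k ih =>
    rw [tpowAppend_succ_left C k 0 k.zero_add, ih]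
    exact (rightUnitor_tensor_hom C (tpow C k)).symm

theorem tpowAppend_comp_tpowSnoc (k l : ℕ) {N : ℕ} (h : l + k = N) (h' : l + 1 + k = N + 1) :
    tpowAppend C k l h ▷ C ≫ (tpowSnoc C N).hom =
      (α_ (tpow C k) (tpow C l) C).hom ≫ tpow C k ◁ (tpowSnoc C l).hom ≫
        tpowAppend C k (l + 1) h' := by
  induction k generalizing N with
  | zero =>
    obtain rfl : l = N := h
    have leftUnitor_comp {X Y : 𝒞} (f : X ⊗ C ⟶ Y) :
        (λ_ X).hom ▷ C ≫ f = (α_ (𝟙_ 𝒞) X C).hom ≫ 𝟙_ 𝒞 ◁ f ≫ (λ_ Y).hom := by simp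
    exact leftUnitor_comp _
  | succ k ih =>
    have whiskerLeft_step {A B D E F : 𝒞} {f : A ⊗ B ⟶ D} {g : D ⊗ C ⟶ F} {s : B ⊗ C ⟶ E}
        {t : A ⊗ E ⟶ F} (hf : f ▷ C ≫ g = (α_ A B C).hom ≫ A ◁ s ≫ t) :
        ((α_ C A B).hom ≫ C ◁ f) ▷ C ≫ (α_ C D C).hom ≫ C ◁ g =
          (α_ (C ⊗ A) B C).hom ≫ (C ⊗ A) ◁ s ≫ (α_ C A E).hom ≫ C ◁ t := by
      calc
        _ = 𝟙 _ ⊗≫ C ◁ (f ▷ C ≫ g) := by monoidal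
        _ = _ := by rw [hf]; monoidal
    subst h
    have hlen : l + 1 + k = l + k + 1 := by omega
    rw [tpowAppend_succ_left C k (l + 1) hlen]
    exact whiskerLeft_step (ih rfl hlen)

theorem tpowSnoc_comp_tpowAppend (k l : ℕ) {N : ℕ} (h : l + (k + 1) = N)
    (h' : l + 1 + k = N) :
    (tpowSnoc C k).hom ▷ tpow C l ≫ tpowAppend C (k + 1) l h =
      (α_ (tpow C k) C (tpow C l)).hom ≫ tpowAppend C k (l + 1) h' := by
  subst h
  induction k with
  | zero =>
    have unitor_coherence (X : 𝒞) :
        ((λ_ C).hom ≫ (ρ_ C).inv) ▷ X ≫ (α_ C (𝟙_ 𝒞) X).hom ≫ C ◁ (λ_ X).hom =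
          (α_ (𝟙_ 𝒞) C X).hom ≫ (λ_ (C ⊗ X)).hom := by monoidal
    exact unitor_coherence _
  | succ k ih =>
    have whiskerLeft_step {A B D E : 𝒞} {s : A ⊗ C ⟶ B} {f : B ⊗ D ⟶ E} {g : A ⊗ C ⊗ D ⟶ E}
        (hf : s ▷ D ≫ f = (α_ A C D).hom ≫ g) :
        ((α_ C A C).hom ≫ C ◁ s) ▷ D ≫ (α_ C B D).hom ≫ C ◁ f =
          (α_ (C ⊗ A) C D).hom ≫ (α_ C A (C ⊗ D)).hom ≫ C ◁ g := by
      calc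
        _ = 𝟙 _ ⊗≫ C ◁ (s ▷ D ≫ f) := by monoidal
        _ = _ := by rw [hf]; monoidal
    have hlen : l + 1 + k = l + (k + 1) := by omega
    rw [tpowAppend_succ_left C k (l + 1) hlen]
    exact whiskerLeft_step (ih hlen)

end Append

theorem whiskerLeft_comp_eq_of_comp_eq {X Y Y' Z : 𝒞} {f : X ⟶ Y} {g : Y ⟶ Z} {f' : X ⟶ Y'}
    {g' : Y' ⟶ Z} (h : f ≫ g = f' ≫ g') : C ◁ f ≫ C ◁ g = C ◁ f' ≫ C ◁ g' := by
  rw [← whiskerLeft_comp, h, whiskerLeft_comp]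

theorem whiskerLeft_comp_eq_id {X Y : 𝒞} {f : X ⟶ Y} {g : Y ⟶ X} (h : f ≫ g = 𝟙 X) :
    C ◁ f ≫ C ◁ g = 𝟙 (C ⊗ X) := by
  rw [← whiskerLeft_comp, h, whiskerLeft_id]

theorem whiskerRight_comp_associator_comp_whiskerLeft {A B D E : 𝒞} {f : A ⟶ B} {s : B ⊗ C ⟶ D}
    {t : A ⊗ C ⟶ E} {g : E ⟶ D} (h : f ▷ C ≫ s = t ≫ g) :
    (C ◁ f) ▷ C ≫ (α_ C B C).hom ≫ C ◁ s = ((α_ C A C).hom ≫ C ◁ t) ≫ C ◁ g := by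
  rw [associator_naturality_middle_assoc, ← whiskerLeft_comp, h, Category.assoc, whiskerLeft_comp]

variable [ComonObj C]

section HeadFactor

/-- The map `Δ_C ⊗ 1_X`. -/
def comulHead (X : 𝒞) : C ⊗ X ⟶ C ⊗ C ⊗ X := Δ[C] ▷ X ≫ (α_ C C X).hom

/-- The map `ε_C ⊗ 1_X`. -/
def counitHead (X : 𝒞) : C ⊗ X ⟶ X := ε[C] ▷ X ≫ (λ_ X).hom

theorem comulHead_naturality {X Y : 𝒞} (f : X ⟶ Y) :
    comulHead C X ≫ C ◁ C ◁ f = C ◁ f ≫ comulHead C Y := by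
  rw [comulHead, comulHead, Category.assoc, ← associator_naturality_right, whisker_exchange_assoc]

theorem counitHead_naturality {X Y : 𝒞} (f : X ⟶ Y) :
    counitHead C X ≫ f = C ◁ f ≫ counitHead C Y := by
  rw [counitHead, counitHead, Category.assoc, ← leftUnitor_naturality, whisker_exchange_assoc]

theorem comulHead_coassoc (X : 𝒞) :
    comulHead C X ≫ C ◁ comulHead C X = comulHead C X ≫ comulHead C (C ⊗ X) := by
  unfold comulHead
  calc
    _ = 𝟙 _ ⊗≫ (Δ[C] ≫ C ◁ Δ[C]) ▷ X ⊗≫ 𝟙 _ := by monoidal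
    _ = _ := by rw [ComonObj.comul_assoc]; monoidal

theorem comulHead_comp_counitHead (X : 𝒞) : comulHead C X ≫ counitHead C (C ⊗ X) = 𝟙 (C ⊗ X) := by
  unfold comulHead counitHead
  calc
    _ = 𝟙 _ ⊗≫ (Δ[C] ≫ ε[C] ▷ C) ▷ X ⊗≫ 𝟙 _ := by monoidal
    _ = _ := by rw [ComonObj.counit_comul]; monoidal

theorem comulHead_comp_whiskerLeft_counitHead (X : 𝒞) :
    comulHead C X ≫ C ◁ counitHead C X = 𝟙 (C ⊗ X) := by
  unfold comulHead counitHead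
  calc
    _ = 𝟙 _ ⊗≫ (Δ[C] ≫ C ◁ ε[C]) ▷ X ⊗≫ 𝟙 _ := by monoidal
    _ = _ := by rw [ComonObj.comul_counit]; monoidal

theorem comulHead_whiskerRight {A B : 𝒞} (s : A ⊗ C ⟶ B) :
    comulHead C A ▷ C ≫ (α_ C (C ⊗ A) C).hom ≫ C ◁ ((α_ C A C).hom ≫ C ◁ s) =
      ((α_ C A C).hom ≫ C ◁ s) ≫ comulHead C B := by
  rw [Category.assoc, ← comulHead_naturality]
  unfold comulHead
  monoidal

theorem counitHead_whiskerRight {A B : 𝒞} (s : A ⊗ C ⟶ B) :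
    counitHead C A ▷ C ≫ s = ((α_ C A C).hom ≫ C ◁ s) ≫ counitHead C B := by
  rw [Category.assoc, ← counitHead_naturality]
  unfold counitHead
  monoidal

theorem counitAt_zero (n : ℕ) : counitAt C n 0 = counitHead C (tpow C n) := by
  cases n <;> rfl

theorem counitAt_succ (n : ℕ) (i : Fin (n + 1)) :
    counitAt C (n + 1) i.succ = C ◁ counitAt C n i := rfl

end HeadFactor

theorem comulAt_comp_comulAt (n : ℕ) (i j : Fin n) (hij : i ≤ j) :
    comulAt C n i ≫ comulAt C (n + 1) j.succ = comulAt C n j ≫ comulAt C (n + 1) i.castSucc := by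
  induction n with
  | zero => exact i.elim0
  | succ n ih =>
    induction i using Fin.cases with
    | zero =>
      induction j using Fin.cases with
      | zero => exact comulHead_coassoc C _
      | succ j => exact comulHead_naturality C _
    | succ i =>
      induction j using Fin.cases with
      | zero => exact absurd hij (by simp)
      | succ j => exact whiskerLeft_comp_eq_of_comp_eq C (ih i j (by simpa using hij))

theorem counitAt_comp_counitAt (n : ℕ) (i j : Fin (n + 1)) (hij : i ≤ j) :
    counitAt C (n + 1) i.castSucc ≫ counitAt C n j =
      counitAt C (n + 1) j.succ ≫ counitAt C n i := by
  induction n with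
  | zero =>
    obtain rfl := Fin.fin_one_eq_zero i
    obtain rfl := Fin.fin_one_eq_zero j
    exact counitHead_naturality C _
  | succ n ih =>
    induction i using Fin.cases with
    | zero => exact counitHead_naturality C _
    | succ i =>
      induction j using Fin.cases with
      | zero => exact absurd hij (by simp)
      | succ j => exact whiskerLeft_comp_eq_of_comp_eq C (ih i j (by simpa using hij))

theorem comulAt_comp_counitAt_castSucc (n : ℕ) (i : Fin n) :
    comulAt C n i ≫ counitAt C n i.castSucc = 𝟙 _ := by
  induction n with
  | zero => exact i.elim0
  | succ n ih =>
    induction i using Fin.cases with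
    | zero => exact comulHead_comp_counitHead C _
    | succ i => exact whiskerLeft_comp_eq_id C (ih i)

theorem comulAt_comp_counitAt_succ (n : ℕ) (i : Fin n) :
    comulAt C n i ≫ counitAt C n i.succ = 𝟙 _ := by
  induction n with
  | zero => exact i.elim0
  | succ n ih =>
    rw [counitAt_succ]
    induction i using Fin.cases with
    | zero =>
      rw [counitAt_zero]
      exact comulHead_comp_whiskerLeft_counitHead C _
    | succ i => exact whiskerLeft_comp_eq_id C (ih i)

theorem comulAt_comp_counitAt_of_lt (n : ℕ) (i : Fin n) (k : Fin (n + 1)) (h : i.castSucc < k) :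
    comulAt C (n + 1) i.castSucc ≫ counitAt C (n + 1) k.succ =
      counitAt C n k ≫ comulAt C n i := by
  induction n with
  | zero => exact i.elim0
  | succ n ih =>
    induction k using Fin.cases with
    | zero => exact absurd h (by simp)
    | succ k =>
      induction i using Fin.cases with
      | zero => exact comulHead_naturality C _
      | succ i => exact whiskerLeft_comp_eq_of_comp_eq C (ih i k (by simpa using h))

theorem comulAt_comp_counitAt_of_ge (n : ℕ) (i : Fin n) (k : Fin (n + 1)) (h : k ≤ i.castSucc) :
    comulAt C (n + 1) i.succ ≫ counitAt C (n + 1) k.castSucc =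
      counitAt C n k ≫ comulAt C n i := by
  induction n with
  | zero => exact i.elim0
  | succ n ih =>
    induction k using Fin.cases with
    | zero => exact (counitHead_naturality C _).symm
    | succ k =>
      induction i using Fin.cases with
      | zero => exact absurd h (by simp)
      | succ i => exact whiskerLeft_comp_eq_of_comp_eq C (ih i k (by simpa using h))

theorem comulAt_comp_tpowSnoc (n : ℕ) (i : Fin n) :
    comulAt C n i ▷ C ≫ (tpowSnoc C (n + 1)).hom =
      (tpowSnoc C n).hom ≫ comulAt C (n + 1) i.castSucc := by
  induction n with
  | zero => exact i.elim0
  | succ n ih =>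
    induction i using Fin.cases with
    | zero => exact comulHead_whiskerRight C (tpowSnoc C n).hom
    | succ i => exact whiskerRight_comp_associator_comp_whiskerLeft C (ih i)

theorem comul_comp_tpowSnoc_last (n : ℕ) :
    tpow C n ◁ Δ[C] ≫ (α_ (tpow C n) C C).inv ≫ (tpowSnoc C n).hom ▷ C ≫
      (tpowSnoc C (n + 1)).hom = (tpowSnoc C n).hom ≫ comulAt C (n + 1) (Fin.last n) := by
  induction n with
  | zero =>
    have unitor_coherence : 𝟙_ 𝒞 ◁ Δ[C] ≫ (α_ (𝟙_ 𝒞) C C).inv ≫ ((λ_ C).hom ≫ (ρ_ C).inv) ▷ C ≫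
        (α_ C (𝟙_ 𝒞) C).hom ≫ C ◁ ((λ_ C).hom ≫ (ρ_ C).inv) =
        ((λ_ C).hom ≫ (ρ_ C).inv) ≫ comulHead C (𝟙_ 𝒞) := by unfold comulHead; monoidal
    exact unitor_coherence
  | succ n ih =>
    have whiskerLeft_step {A B D : 𝒞} {s : A ⊗ C ⟶ B} {t : B ⊗ C ⟶ D} {g : B ⟶ D}
        (h : A ◁ Δ[C] ≫ (α_ A C C).inv ≫ s ▷ C ≫ t = s ≫ g) :
        (C ⊗ A) ◁ Δ[C] ≫ (α_ (C ⊗ A) C C).inv ≫ ((α_ C A C).hom ≫ C ◁ s) ▷ C ≫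
          (α_ C B C).hom ≫ C ◁ t = ((α_ C A C).hom ≫ C ◁ s) ≫ C ◁ g := by
      calc
        _ = 𝟙 _ ⊗≫ C ◁ (A ◁ Δ[C] ≫ (α_ A C C).inv ≫ s ▷ C ≫ t) := by monoidal
        _ = _ := by rw [h]; monoidal
    exact whiskerLeft_step ih

theorem counitAt_comp_tpowSnoc (n : ℕ) (i : Fin (n + 1)) :
    counitAt C n i ▷ C ≫ (tpowSnoc C n).hom =
      (tpowSnoc C (n + 1)).hom ≫ counitAt C (n + 1) i.castSucc := by
  induction n with
  | zero =>
    obtain rfl := Fin.fin_one_eq_zero i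
    exact counitHead_whiskerRight C _
  | succ n ih =>
    induction i using Fin.cases with
    | zero => exact counitHead_whiskerRight C _
    | succ i => exact whiskerRight_comp_associator_comp_whiskerLeft C (ih i)

theorem counit_comp_tpowSnoc_last (n : ℕ) :
    tpow C n ◁ ε[C] ≫ (ρ_ (tpow C n)).hom = (tpowSnoc C n).hom ≫ counitAt C n (Fin.last n) := by
  induction n with
  | zero =>
    have unitor_coherence : 𝟙_ 𝒞 ◁ ε[C] ≫ (ρ_ (𝟙_ 𝒞)).hom =
        ((λ_ C).hom ≫ (ρ_ C).inv) ≫ counitHead C (𝟙_ 𝒞) := by unfold counitHead; monoidal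
    exact unitor_coherence
  | succ n ih =>
    have whiskerLeft_step {A B : 𝒞} {s : A ⊗ C ⟶ B} {g : B ⟶ A}
        (h : A ◁ ε[C] ≫ (ρ_ A).hom = s ≫ g) :
        (C ⊗ A) ◁ ε[C] ≫ (ρ_ (C ⊗ A)).hom = ((α_ C A C).hom ≫ C ◁ s) ≫ C ◁ g := by
      rw [Category.assoc, ← whiskerLeft_comp, ← h]
      monoidal
    exact whiskerLeft_step ih

end TensorPowerIdentities

section CoactionOfRotation

variable {𝒞 : Type u} [Category.{v} 𝒞] [MonoidalCategory 𝒞] {H M : 𝒞} [ComonObj H]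

theorem whiskerLeft_comp_coactMap_rotate_comp [BraidedCategory 𝒞] [LeftComodObj H M]
    {V X Y X' Y' : 𝒞} (φ : H ⊗ V ⟶ V) {f : X ⟶ Y} {s : X ⊗ V ⟶ X'} {s' : Y ⊗ V ⟶ Y'}
    {g : X' ⟶ Y'} (h : f ▷ V ≫ s' = s ≫ g) :
    M ◁ (V ◁ f) ≫ coactMap M (rotate φ Y ≫ s') = coactMap M (rotate φ X ≫ s) ≫ M ◁ g := by
  rw [whiskerLeft_comp_coactMap, coactMap_comp_whiskerLeft,
    ← Category.assoc (H ◁ _), rotate_naturality_right, Category.assoc, Category.assoc, h]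

variable [SymmetricCategory 𝒞] [LeftComodObj H M]

theorem coactMap_rotate_comp_coactMap_rotate {V W X Y : 𝒞} (φ : H ⊗ V ⟶ V) (χ : H ⊗ W ⟶ W)
    (s : X ⊗ V ⟶ Y) :
    coactMap M (rotate φ (W ⊗ X) ≫ (α_ W X V).hom ≫ W ◁ s) ≫ coactMap M (rotate χ Y) =
      M ◁ (α_ V W X).inv ≫ coactMap M (rotate (tensorAct φ χ) X ≫ (α_ X V W).inv ≫ s ▷ W) := by
  calc
    _ = coactMap M (rotate φ (W ⊗ X) ≫ (α_ W X V).hom) ≫ coactMap M (rotate χ (X ⊗ V)) ≫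
        M ◁ (s ▷ W) := by
      rw [coactMap_comp_whiskerLeft, ← rotate_naturality_right, ← whiskerLeft_comp_coactMap,
        ← Category.assoc (coactMap M _) (M ◁ _), coactMap_comp_whiskerLeft, Category.assoc]
    _ = _ := by
      rw [← Category.assoc, coactMap_comp_coactMap, cokleisliComp_rotate,
        ← whiskerLeft_comp_coactMap, Category.assoc, coactMap_comp_whiskerLeft, Category.assoc]

theorem whiskerLeft_append_comp_coactMap_rotate {V W X N N' L : 𝒞} {φ : H ⊗ W ⟶ W}
    (χ : H ⊗ V ⟶ V) {e : W ⊗ X ⟶ N'} {sN : N' ⊗ V ⟶ N} {sX : X ⊗ V ⟶ L} {e₁ : W ⊗ L ⟶ N}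
    {e₂ : L ⊗ W ⟶ N} {e₃ : X ⊗ (V ⊗ W) ⟶ N} {P : M ⊗ N ⟶ M ⊗ N}
    (he : e ▷ V ≫ sN = (α_ W X V).hom ≫ W ◁ sX ≫ e₁)
    (hP : M ◁ e₁ ≫ P = coactMap M (rotate φ L ≫ e₂))
    (he₂ : sX ▷ W ≫ e₂ = (α_ X V W).hom ≫ e₃) :
    M ◁ ((α_ V W X).hom ≫ V ◁ e) ≫ coactMap M (rotate χ N' ≫ sN) ≫ P =
      coactMap M (rotate (tensorAct χ φ) X ≫ e₃) := by
  calc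
    _ = M ◁ (α_ V W X).hom ≫ coactMap M (rotate χ (W ⊗ X) ≫ (α_ W X V).hom ≫ W ◁ sX) ≫
        M ◁ e₁ ≫ P := by
      have he' : e ▷ V ≫ sN = ((α_ W X V).hom ≫ W ◁ sX) ≫ e₁ := by rw [he, Category.assoc]
      rw [whiskerLeft_comp_assoc, reassoc_of% whiskerLeft_comp_coactMap_rotate_comp χ he']
    _ = coactMap M (rotate (tensorAct χ φ) X ≫ (α_ X V W).inv ≫ sX ▷ W ≫ e₂) := by
      rw [hP, ← coactMap_comp_whiskerLeft M (rotate φ L),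
        reassoc_of% coactMap_rotate_comp_coactMap_rotate (M := M) χ φ sX,
        ← whiskerLeft_comp_assoc, Iso.hom_inv_id, whiskerLeft_id, Category.id_comp,
        coactMap_comp_whiskerLeft]
      simp only [Category.assoc]
    _ = _ := by rw [he₂, Iso.inv_hom_id_assoc]

end CoactionOfRotation

section CyclicMap

variable {𝒞 : Type u} [Category.{v} 𝒞] [MonoidalCategory 𝒞]

section

variable [BraidedCategory 𝒞] (H C M : 𝒞) [MonObj H] [ComonObj H] [ModObj H C] [LeftComodObj H M]

/-- The cyclic operator `τ_n`, which is `m ⊗ c ⊗ x ↦ m₍₀₎ ⊗ x ⊗ m₍₋₁₎ c`. -/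
def cyclicMap (n : ℕ) : M ⊗ tpow C (n + 1) ⟶ M ⊗ tpow C (n + 1) :=
  coactMap M (rotate γ[H, C] (tpow C n) ≫ (tpowSnoc C n).hom)

variable [ComonObj C]

theorem comulAt_succ_comp_cyclicMap (n : ℕ) (i : Fin n) :
    M ◁ comulAt C (n + 1) i.succ ≫ cyclicMap H C M (n + 1) =
      cyclicMap H C M n ≫ M ◁ comulAt C (n + 1) i.castSucc :=
  whiskerLeft_comp_coactMap_rotate_comp _ (comulAt_comp_tpowSnoc C n i)

theorem counitAt_succ_comp_cyclicMap (n : ℕ) (i : Fin (n + 1)) :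
    M ◁ counitAt C (n + 1) i.succ ≫ cyclicMap H C M n =
      cyclicMap H C M (n + 1) ≫ M ◁ counitAt C (n + 1) i.castSucc :=
  whiskerLeft_comp_coactMap_rotate_comp _ (counitAt_comp_tpowSnoc C n i)

end

section

variable [BraidedCategory 𝒞] (H C M : 𝒞) [HopfObj H] [ModuleCoalgObj H C] [LeftComodObj H M]

theorem cyclicMap_comp_counitAt_last (n : ℕ) :
    cyclicMap H C M n ≫ M ◁ counitAt C n (Fin.last n) = M ◁ counitAt C n 0 := by
  have counit_kills_rotated {X B : 𝒞} {s : X ⊗ C ⟶ B} {g : B ⟶ X}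
      (h : X ◁ ε[C] ≫ (ρ_ X).hom = s ≫ g) :
      coactMap M (rotate γ[H, C] X ≫ s) ≫ M ◁ g = M ◁ counitHead C X := by
    have hcounit := (intertwines_counit H C).rotate_naturality_left X
    rw [coactMap_comp_whiskerLeft, Category.assoc, ← h, ← reassoc_of% hcounit, rotate_unitAct,
      ← whiskerLeft_comp_coactMap, counitHead]
    simp only [Category.assoc, Iso.inv_hom_id, Category.comp_id]
    rw [← Category.assoc (ε[H] ▷ _), ← coactMap_comp_whiskerLeft, coactMap_counit,
      Category.id_comp, ← whiskerLeft_comp]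
  rw [counitAt_zero]
  exact counit_kills_rotated (counit_comp_tpowSnoc_last C n)

end

section

variable [SymmetricCategory 𝒞] (H C M : 𝒞) [HopfObj H] [ModuleCoalgObj H C] [LeftComodObj H M]

theorem comulAt_zero_comp_cyclicMap_comp_cyclicMap (n : ℕ) :
    (M ◁ comulAt C (n + 1) 0 ≫ cyclicMap H C M (n + 1)) ≫ cyclicMap H C M (n + 1) =
      cyclicMap H C M n ≫ M ◁ comulAt C (n + 1) (Fin.last n) := by
  have rotate_both_copies {X B D : 𝒞} {s : X ⊗ C ⟶ B} {t : B ⊗ C ⟶ D} {g : B ⟶ D}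
      (h : X ◁ Δ[C] ≫ (α_ X C C).inv ≫ s ▷ C ≫ t = s ≫ g) :
      (M ◁ comulHead C X ≫ coactMap M (rotate γ[H, C] (C ⊗ X) ≫ (α_ C X C).hom ≫ C ◁ s)) ≫
          coactMap M (rotate γ[H, C] B ≫ t) =
        coactMap M (rotate γ[H, C] X ≫ s) ≫ M ◁ g := by
    have hcomul := (intertwines_comul H C).rotate_naturality_left X
    rw [← coactMap_comp_whiskerLeft M (rotate _ B), Category.assoc,
      reassoc_of% coactMap_rotate_comp_coactMap_rotate (M := M) γ[H, C] γ[H, C] s, comulHead,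
      ← whiskerLeft_comp_assoc, Category.assoc, Iso.hom_inv_id, Category.comp_id,
      ← Category.assoc, whiskerLeft_comp_coactMap, reassoc_of% hcomul,
      coactMap_comp_whiskerLeft, coactMap_comp_whiskerLeft]
    simp only [Category.assoc, h]
  exact rotate_both_copies (comul_comp_tpowSnoc_last C n)

end

section

variable [SymmetricCategory 𝒞] (H C M : 𝒞) [HopfObj H] [ModObj H C] [LeftComodObj H M]

theorem tpowAppend_comp_cyclicMap_pow {n : ℕ} (k l : ℕ) (h : l + k = n + 1)
    (h' : k + l = n + 1) :
    M ◁ tpowAppend C k l h ≫ (End.of (cyclicMap H C M n) ^ k : End _) =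
      coactMap M (rotate (diagAct H C k) (tpow C l) ≫ tpowAppend C l k h') := by
  induction k generalizing l with
  | zero =>
    obtain rfl : l = n + 1 := h
    have rotate_unit (X : 𝒞) :
        M ◁ (λ_ X).hom ≫ 𝟙 _ = coactMap M (rotate (unitAct H) X ≫ (ρ_ X).hom) := by
      rw [rotate_unitAct]
      simp only [Category.assoc, Iso.inv_hom_id, Category.comp_id]
      rw [← Category.assoc, ← coactMap_comp_whiskerLeft, coactMap_counit, Category.id_comp]
    rw [tpowAppend_zero_left, tpowAppend_zero_right, diagAct_zero, pow_zero]
    exact rotate_unit _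
  | succ k ih =>
    rw [pow_succ, End.mul_def, diagAct_succ, tpowAppend_succ_left C k l (N := n) (by omega)]
    have hlen : l + 1 + k = n + 1 := by omega
    exact whiskerLeft_append_comp_coactMap_rotate _ (tpowAppend_comp_tpowSnoc C k l (by omega) hlen)
      (ih (l + 1) hlen (by omega)) (tpowSnoc_comp_tpowAppend C l k (by omega) h')

theorem cyclicMap_pow (n : ℕ) :
    (End.of (cyclicMap H C M n) ^ (n + 1) : End _) = coactMap M (diagAct H C (n + 1)) := by
  have rotate_unit {V : 𝒞} (φ : H ⊗ V ⟶ V) :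
      coactMap M (rotate φ (𝟙_ 𝒞) ≫ (λ_ V).hom) = M ◁ (ρ_ V).hom ≫ coactMap M φ := by
    rw [rotate_tensorUnit, whiskerLeft_comp_coactMap]
    simp only [Category.assoc, Iso.inv_hom_id, Category.comp_id]
  have h := tpowAppend_comp_cyclicMap_pow H C M (n + 1) 0 (Nat.zero_add _) rfl
  rw [tpowAppend_zero_left, tpowAppend_zero_right] at h
  rw [← cancel_epi (M ◁ (ρ_ (tpow C (n + 1))).hom)]
  exact h.trans (rotate_unit _)

end

end CyclicMap

section Operators

variable {𝒞 : Type u} [Category.{v} 𝒞] [MonoidalCategory 𝒞]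

section

variable [BraidedCategory 𝒞] (H C M : 𝒞) [HopfObj H] [ModuleCoalgObj H C] [SAYDObj H M]

theorem operators_τ (n : ℕ) : (operators H C M).τ n = cyclicMap H C M n := by
  have coactMap_eq {X Y : 𝒞} (s : X ⊗ C ⟶ Y) :
      (LeftComodObj.coact : M ⟶ H ⊗ M) ▷ (C ⊗ X) ≫ (β_ H M).hom ▷ (C ⊗ X) ≫
        (α_ M H (C ⊗ X)).hom ≫ M ◁ ((α_ H C X).inv ≫ γ[H, C] ▷ X ≫ (β_ C X).hom ≫ s) =
      coactMap M (rotate γ[H, C] X ≫ s) := by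
    simp only [coactMap, rotate, rightCoact, comp_whiskerRight, Category.assoc]
  exact coactMap_eq _

theorem operators_δ_castSucc (n : ℕ) (i : Fin (n + 1)) :
    (operators H C M).δ n i.castSucc = M ◁ comulAt C (n + 1) i := by
  simp only [operators, Fin.lastCases_castSucc]

theorem operators_σ (n : ℕ) (i : Fin (n + 1)) :
    (operators H C M).σ n i = M ◁ counitAt C (n + 1) i.succ := rfl

theorem operators_δ_last (n : ℕ) :
    (operators H C M).δ n (Fin.last (n + 1)) =
      M ◁ comulAt C (n + 1) 0 ≫ cyclicMap H C M (n + 1) := by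
  rw [← operators_τ]
  simp only [operators, Fin.lastCases_last]
  rw [MonoidalCategory.tensorHom_def', Category.assoc]

theorem operators_δ_succ_comp_σ (n : ℕ) (i : Fin (n + 1)) :
    (operators H C M).δ n i.succ ≫ (operators H C M).σ n i = 𝟙 _ := by
  rw [operators_σ]
  induction i using Fin.lastCases with
  | last =>
    rw [Fin.succ_last, operators_δ_last, Category.assoc,
      cyclicMap_comp_counitAt_last]
    exact whiskerLeft_comp_eq_id M (comulAt_comp_counitAt_castSucc C (n + 1) 0)
  | cast i =>
    rw [Fin.succ_castSucc, operators_δ_castSucc]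
    exact whiskerLeft_comp_eq_id M (comulAt_comp_counitAt_castSucc C _ _)

theorem operators_σ_zero_comp_τ (n : ℕ) :
    (operators H C M).σ n 0 ≫ (operators H C M).τ n =
      (operators H C M).τ (n + 1) ≫ (operators H C M).τ (n + 1) ≫
        (operators H C M).σ n (Fin.last n) := by
  have h := counitAt_succ_comp_cyclicMap H C M n 0
  rw [Fin.castSucc_zero, ← cyclicMap_comp_counitAt_last] at h
  rw [operators_τ, operators_τ, operators_σ, operators_σ, h, Fin.succ_last]

end

section

variable [SymmetricCategory 𝒞] (H C M : 𝒞) [HopfObj H] [ModuleCoalgObj H C] [SAYDObj H M]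

theorem operators_δ_succ_comp_τ (n : ℕ) (i : Fin (n + 1)) :
    (operators H C M).δ n i.succ ≫ (operators H C M).τ (n + 1) =
      (operators H C M).τ n ≫ (operators H C M).δ n i.castSucc := by
  rw [operators_τ, operators_τ, operators_δ_castSucc]
  induction i using Fin.lastCases with
  | last =>
    rw [Fin.succ_last, operators_δ_last, comulAt_zero_comp_cyclicMap_comp_cyclicMap]
  | cast i => rw [Fin.succ_castSucc, operators_δ_castSucc, comulAt_succ_comp_cyclicMap]

theorem operators_isParacocyclic : (operators H C M).IsParacocyclic := by
  constructor
  case δ_comp_σ_succ => exact operators_δ_succ_comp_σ H C M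
  case δ_succ_comp_τ => exact operators_δ_succ_comp_τ H C M
  case σ_zero_comp_τ => exact operators_σ_zero_comp_τ H C M
  all_goals intros; simp only [operators_δ_castSucc, operators_σ, operators_τ]
  case inner_δ_comp_δ hij =>
    simp only [Fin.succ_castSucc, operators_δ_castSucc]
    exact whiskerLeft_comp_eq_of_comp_eq M (comulAt_comp_comulAt C _ _ _ hij)
  case σ_comp_σ n i j hij =>
    exact whiskerLeft_comp_eq_of_comp_eq M
      (counitAt_comp_counitAt C _ i.succ j.succ (by simpa using hij))
  case inner_δ_comp_σ_of_le hij =>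
    exact whiskerLeft_comp_eq_of_comp_eq M
      (comulAt_comp_counitAt_of_lt C _ _ _ (by simpa [Fin.lt_def, Nat.lt_succ_iff] using hij))
  case δ_comp_σ_self =>
    exact whiskerLeft_comp_eq_id M (comulAt_comp_counitAt_succ C _ _)
  case inner_δ_comp_σ_of_gt hij =>
    simp only [Fin.succ_castSucc, operators_δ_castSucc]
    exact whiskerLeft_comp_eq_of_comp_eq M
      (comulAt_comp_counitAt_of_ge C _ _ _ (Fin.le_def.2 (Nat.succ_le_of_lt hij)))
  case δ_zero_comp_τ n =>
    rw [operators_δ_last, ← operators_δ_castSucc, Fin.castSucc_zero]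
  case σ_succ_comp_τ n i =>
    exact counitAt_succ_comp_cyclicMap H C M n i.succ

end

end Operators

section Descent

variable {𝒞 : Type u} [Category.{v} 𝒞] [MonoidalCategory 𝒞] [Abelian 𝒞]

section

variable [BraidedCategory 𝒞]
variable (H C M : 𝒞) [HopfObj H] [ModuleCoalgObj H C] [SAYDObj H M]

instance epi_balancedπ (n : ℕ) : Epi (balancedπ H C M n) :=
  inferInstanceAs (Epi (cokernel.π _))

theorem balances_balancedπ (n : ℕ) : Balances (diagAct H C (n + 1)) (balancedπ H C M n) := by
  have h := cokernel.condition
    (balancingMap (RightModObj.act : M ⊗ H ⟶ M) (diagAct H C (n + 1)))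
  rw [balancingMap, Preadditive.sub_comp, sub_eq_zero, Category.assoc] at h
  exact h

theorem balances_operators_σ (n : ℕ) (i : Fin (n + 1)) :
    Balances (diagAct H C (n + 2)) ((operators H C M).σ n i ≫ balancedπ H C M n) :=
  (balances_balancedπ H C M n).precomp (intertwines_counitAt H C (n + 1) i.succ)

section

variable {H C M} {n : ℕ} {Z : 𝒞} (f : M ⊗ tpow C (n + 1) ⟶ Z)
  (hf : Balances (diagAct H C (n + 1)) f)

/-- The map out of `M ⊗_H C ^ (n + 1)` induced by a balanced map. -/
def balancedDesc : balanced H C M n ⟶ Z :=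
  cokernel.desc _ f (by
    rw [balancingMap, Preadditive.sub_comp, sub_eq_zero, Category.assoc]
    exact hf)

theorem balancedπ_comp_balancedDesc : balancedπ H C M n ≫ balancedDesc f hf = f :=
  cokernel.π_desc _ _ _

end

variable {H C M} {D E : CocyclicOperators (balanced H C M)}

theorem IsInduced.isHom (hD : IsInduced H C M D) : (operators H C M).IsHom D (balancedπ H C M) where
  __ := hD

theorem IsInduced.unique (hD : IsInduced H C M D) (hE : IsInduced H C M E) : D = E :=
  hD.isHom.unique hE.isHom

end

section

variable [SymmetricCategory 𝒞]
variable (H C M : 𝒞) [HopfObj H] [ModuleCoalgObj H C] [SAYDObj H M]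

theorem balances_cyclicMap (n : ℕ) :
    Balances (diagAct H C (n + 1)) (cyclicMap H C M n ≫ balancedπ H C M n) := by
  have h := ((balances_balancedπ H C M n).precomp (intertwines_tpowSnoc H C n)).rotate
  rw [← diagAct_succ, ← Category.assoc, coactMap_comp_whiskerLeft] at h
  exact h

theorem balances_operators_δ (n : ℕ) (i : Fin (n + 2)) :
    Balances (diagAct H C (n + 1)) ((operators H C M).δ n i ≫ balancedπ H C M (n + 1)) := by
  induction i using Fin.lastCases with
  | last =>
    rw [operators_δ_last, Category.assoc]
    exact (balances_cyclicMap H C M (n + 1)).precomp (intertwines_comulAt H C (n + 1) 0)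
  | cast i =>
    rw [operators_δ_castSucc]
    exact (balances_balancedπ H C M (n + 1)).precomp (intertwines_comulAt H C (n + 1) i)

theorem balances_operators_τ (n : ℕ) :
    Balances (diagAct H C (n + 1)) ((operators H C M).τ n ≫ balancedπ H C M n) := by
  rw [operators_τ]
  exact balances_cyclicMap H C M n

/-- The operators on `M ⊗_H C ^ (n + 1)` induced by those on `M ⊗ C ^ (n + 1)`. -/
def balancedOperators : CocyclicOperators (balanced H C M) where
  δ n i := balancedDesc _ (balances_operators_δ H C M n i)
  σ n i := balancedDesc _ (balances_operators_σ H C M n i)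
  τ n := balancedDesc _ (balances_operators_τ H C M n)

theorem isInduced_balancedOperators : IsInduced H C M (balancedOperators H C M) where
  δ n i := balancedπ_comp_balancedDesc _ (balances_operators_δ H C M n i)
  σ n i := balancedπ_comp_balancedDesc _ (balances_operators_σ H C M n i)
  τ n := balancedπ_comp_balancedDesc _ (balances_operators_τ H C M n)

namespace IsInduced

variable {H C M} {D : CocyclicOperators (balanced H C M)}

theorem τ_pow (hD : IsInduced H C M D) (n : ℕ) : End.of (D.τ n) ^ (n + 1) = 1 := by
  rw [← cancel_epi (balancedπ H C M n), hD.isHom.τ_pow, operators_τ, cyclicMap_pow,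
    (balances_balancedπ H C M n).coactMap_comp]
  exact (Category.comp_id _).symm

theorem isCocyclic (hD : IsInduced H C M D) : D.IsCocyclic :=
  (hD.isHom.isParacocyclic (operators_isParacocyclic H C M)).isCocyclic hD.τ_pow

end IsInduced

end

end Descent

end BraidedHopfCyclic

end

theorem mainTheorem1 {𝒞 : Type u} [Category.{v} 𝒞] [MonoidalCategory 𝒞] [SymmetricCategory 𝒞]
    [Abelian 𝒞] (H C M : 𝒞) [HopfObj H] [BraidedHopfCyclic.ModuleCoalgObj H C]
    [BraidedHopfCyclic.SAYDObj H M] :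
    (∃! D : BraidedHopfCyclic.CocyclicOperators (BraidedHopfCyclic.balanced H C M),
      BraidedHopfCyclic.IsInduced H C M D) ∧
    ∀ D : BraidedHopfCyclic.CocyclicOperators (BraidedHopfCyclic.balanced H C M),
      BraidedHopfCyclic.IsInduced H C M D → D.IsCocyclic :=
  ⟨⟨_, BraidedHopfCyclic.isInduced_balancedOperators H C M,
    fun _ hD => hD.unique (BraidedHopfCyclic.isInduced_balancedOperators H C M)⟩,
    fun _ hD => hD.isCocyclic⟩
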